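/- Let $d,k\ge 0$ and $N\ge 1$ be integers. Let $T_{d,k}=\bigoplus_{\ell=0}^{k}(\mathbb{R}^d)^{\otimes \ell}$ be the truncated tensor algebra (tensor products of total level larger than $k$ are set to $0$), let $\mathfrak{g}_{d,k}\subseteq T_{d,k}$ be the smallest Lie subalgebra, with respect to the commutator bracket, that contains the standard basis vectors $\mathrm{e}_1,\dots,\mathrm{e}_d$ of $\mathbb{R}^d$ ($\mathfrak{g}_{d,0}=0$), and let $\mathcal{G}_{d,k}=\exp(\mathfrak{g}_{d,k})$ be the free nilpotent Lie group, with inverse $\log:\mathcal{G}_{d,k}\to\mathfrak{g}_{d,k}$ of $\exp$. A barycenter of a sample $(\mathbf{x}_1,\dots,\mathbf{x}_N)\in\mathcal{G}_{d,k}^N$ is an element $\mathbf{m}\in\mathcal{G}_{d,k}$ with $\sum_{i=1}^N\log(\mathbf{m}^{-1}\mathbf{x}_i)=0$. For $m\ge 1$ let $\mathcal{L}^{\mathrm{im}}_{d,\le k,m}\subseteq T_{d,k}$ be the set of all $k$-truncated iterated-integrals signatures $\sigma(X)$ of piecewise linear paths $X:[0,1]\to\mathbb{R}^d$ with $X(0)=0$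 and with $m$ segments (constant segments and collinear consecutive segments are allowed); here $\sigma(X)$ has constant component $1$ and entries $$\sigma_{w_1\dots w_\ell}=\int_0^1\int_0^{t_\ell}\cdots\int_0^{t_2}\dot X_{w_1}(t_1)\cdots\dot X_{w_\ell}(t_\ell)\,\mathrm{d}t_1\cdots\mathrm{d}t_\ell ,\qquad 1\le \ell\le k .$$ Then, for every $\alpha=(\alpha_1,\dots,\alpha_N)$ with integers $\alpha_i\ge 1$, the barycenter recovery order $$B_{d,k}(\alpha):=\min\Big\{m\ge 1\;\Big|\;\mathsf{bary}\big(\mathcal{L}^{\mathrm{im}}_{d,\le k,\alpha_1}\times\dots\times\mathcal{L}^{\mathrm{im}}_{d,\le k,\alpha_N}\big)\subseteq\mathcal{L}^{\mathrm{im}}_{d,\le k,m}\Big\}$$ is well defined. That is, $\mathcal{L}^{\mathrm{im}}_{d,\le k,\alpha_i}\subseteq\mathcal{G}_{d,k}$ for every $i$; every sample in $\mathcal{G}_{d,k}^N$ has exactly one barycenter, denoted by $\mathsf{bary}(\mathbf{x}_1,\dots,\mathbf{x}_N)$; and the minimum is attained, i.e. the set of such $m$ is non-empty. -/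

import Mathlib

noncomputable section

namespace BarySig

/-! ### The truncated tensor algebra -/

/-- Words of length at most `k` over the alphabet `{0, …, d - 1}`. A multi-index
`(i₁, …, i_ℓ)` of an `ℓ`-tensor is the word `[i₁, …, i_ℓ]`. -/
abbrev Word (d k : ℕ) : Type := {w : List (Fin d) // w.length ≤ k}

/-- The truncated tensor algebra `T_{d,k} = ⨁_{ℓ ≤ k} (ℝ^d)^{⊗ ℓ}`: an element is the family of
the entries of its tensors of levels `0, …, k`. -/
def TensorSeq (d k : ℕ) : Type := Word d k → ℝ

namespace TensorSeq

variable {d k : ℕ}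

instance : AddCommGroup (TensorSeq d k) := inferInstanceAs (AddCommGroup (Word d k → ℝ))

instance : Module ℝ (TensorSeq d k) := inferInstanceAs (Module ℝ (Word d k → ℝ))

@[ext] theorem ext {a b : TensorSeq d k} (h : ∀ w, a w = b w) : a = b := funext h

@[simp] theorem add_apply (a b : TensorSeq d k) (w : Word d k) : (a + b) w = a w + b w := rfl

@[simp] theorem zero_apply (w : Word d k) : (0 : TensorSeq d k) w = 0 := rfl

@[simp] theorem smul_apply (r : ℝ) (a : TensorSeq d k) (w : Word d k) :
    (r • a) w = r * a w := rfl

/-- The first `i` letters of a word. -/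
def _root_.BarySig.Word.take (w : Word d k) (i : ℕ) : Word d k :=
  ⟨w.1.take i, (List.length_take_le' i w.1).trans w.2⟩

/-- A word without its first `i` letters. -/
def _root_.BarySig.Word.drop (w : Word d k) (i : ℕ) : Word d k :=
  ⟨w.1.drop i, by rw [List.length_drop]; exact (Nat.sub_le _ _).trans w.2⟩

/-- The unit: the `0`-tensor `1`. -/
instance : One (TensorSeq d k) := ⟨fun w => if w.1 = [] then 1 else 0⟩

/-- The tensor product `c_{i₁ … i_{ℓ+n}} = a_{i₁ … i_ℓ} · b_{i_{ℓ+1} … i_{ℓ+n}}` of tensors,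
extended bilinearly to sequences of tensors and set to zero above level `k`. -/
instance : Mul (TensorSeq d k) :=
  ⟨fun a b w => ∑ i ∈ Finset.range (w.1.length + 1), a (w.take i) * b (w.drop i)⟩

theorem one_apply (w : Word d k) : (1 : TensorSeq d k) w = if w.1 = [] then 1 else 0 := rfl

theorem mul_apply (a b : TensorSeq d k) (w : Word d k) :
    (a * b) w = ∑ i ∈ Finset.range (w.1.length + 1), a (w.take i) * b (w.drop i) := rfl

theorem mul_assoc' (a b c : TensorSeq d k) : a * b * c = a * (b * c) := by
  ext w
  simp only [mul_apply, Finset.sum_mul, Finset.mul_sum]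
  rw [Finset.sum_sigma', Finset.sum_sigma']
  refine Finset.sum_bij' (fun p _ => ⟨p.2, p.1 - p.2⟩) (fun p _ => ⟨p.1 + p.2, p.1⟩) ?_ ?_ ?_ ?_ ?_
  · rintro ⟨i, j⟩ h
    simp [Word.take, Word.drop] at h ⊢
    omega
  · rintro ⟨i, j⟩ h
    simp [Word.take, Word.drop] at h ⊢
    omega
  · rintro ⟨i, j⟩ h
    simp [Word.take, Word.drop] at h ⊢
    omega
  · rintro ⟨i, j⟩ h
    simp
  · rintro ⟨i, j⟩ h
    simp [Word.take] at h
    have hij : j ≤ i := by omega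
    have h1 : (w.take i).take j = w.take j := by
      apply Subtype.ext
      simp [Word.take, List.take_take, hij]
    have h2 : (w.take i).drop j = (w.drop j).take (i - j) := by
      apply Subtype.ext
      simp [Word.take, Word.drop, List.drop_take]
    have h3 : w.drop i = (w.drop j).drop (i - j) := by
      apply Subtype.ext
      simp [Word.drop, List.drop_drop, hij]
    simp only [h1, h2, ← h3, mul_assoc]

theorem one_mul' (a : TensorSeq d k) : 1 * a = a := by
  ext w
  rw [mul_apply, Finset.sum_eq_single 0]
  · simp [one_apply, Word.take, Word.drop]
  · intro i hi h0
    have : (w.take i).1 ≠ [] := by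
      intro h
      have h' := congrArg List.length h
      simp [Word.take] at h' hi
      have : w.1.length = 0 ∨ i = 0 := by
        rcases h' with h' | h'
        · exact Or.inr h'
        · exact Or.inl (by simp [h'])
      omega
    simp [one_apply, this]
  · simp

theorem mul_one' (a : TensorSeq d k) : a * 1 = a := by
  ext w
  rw [mul_apply, Finset.sum_eq_single w.1.length]
  · simp [one_apply, Word.take, Word.drop]
  · intro i hi h0
    have : (w.drop i).1 ≠ [] := by
      intro h
      have h' := congrArg List.length h
      simp [Word.drop] at h' hi
      omega
    simp [one_apply, this]
  · simp

instance : Ring (TensorSeq d k) :=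
  { (inferInstance : AddCommGroup (TensorSeq d k)) with
    mul := (· * ·)
    one := 1
    mul_assoc := mul_assoc'
    one_mul := one_mul'
    mul_one := mul_one'
    left_distrib := fun a b c => by
      ext w; simp [mul_apply, mul_add, Finset.sum_add_distrib]
    right_distrib := fun a b c => by
      ext w; simp [mul_apply, add_mul, Finset.sum_add_distrib]
    zero_mul := fun a => by ext w; simp [mul_apply]
    mul_zero := fun a => by ext w; simp [mul_apply] }

instance : Algebra ℝ (TensorSeq d k) :=
  Algebra.ofModule
    (fun r a b => by ext w; simp [mul_apply, Finset.mul_sum, mul_assoc])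
    (fun r a b => by ext w; simp [mul_apply, Finset.mul_sum, mul_left_comm])

/-- The commutator bracket `⁅y, z⁆ = y * z - z * y`. -/
instance : LieRing (TensorSeq d k) := LieRing.ofAssociativeRing

end TensorSeq

/-! ### The free nilpotent Lie algebra and Lie group -/

/-- The `i`-th standard basis vector of `ℝ^d`, as a tensor sequence concentrated in level one
(it is `0` if `k = 0`). -/
def letter (d k : ℕ) (i : Fin d) : TensorSeq d k := fun w => if w.1 = [i] then 1 else 0

/-- The free nilpotent Lie algebra `𝔤_{d,k}`: the smallest Lie subalgebra of `T_{d,k}`, with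
the commutator bracket, that contains the standard basis vectors. -/
def freeNilLie (d k : ℕ) : LieSubalgebra ℝ (TensorSeq d k) :=
  LieSubalgebra.lieSpan ℝ (TensorSeq d k) (Set.range (letter d k))

/-- The exponential series; the powers beyond the `k`-th vanish on elements without constant
component, in particular on `𝔤_{d,k}`. -/
def texp {d k : ℕ} (z : TensorSeq d k) : TensorSeq d k :=
  ∑ l ∈ Finset.range (k + 1), ((l.factorial : ℝ)⁻¹) • z ^ l

/-- The logarithm series; the powers of `s - 1` beyond the `k`-th vanish if the constant
component of `s` is `1`, in particular on the free nilpotent Lie group. -/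
def tlog {d k : ℕ} (s : TensorSeq d k) : TensorSeq d k :=
  ∑ l ∈ Finset.Icc 1 k, ((-1 : ℝ) ^ (l + 1) / (l : ℝ)) • (s - 1) ^ l

/-- The free nilpotent Lie group `𝒢_{d,k} = exp 𝔤_{d,k}`, as a subset of `T_{d,k}`. -/
def freeNilGroup (d k : ℕ) : Set (TensorSeq d k) :=
  texp '' (freeNilLie d k : Set (TensorSeq d k))

/-! ### Barycenters -/

/-- The group element `m` is a barycenter of the sample `x₁, …, x_N`:
`∑ᵢ log (m⁻¹ xᵢ) = 0`. The inverse is taken in `T_{d,k}`, where every element with constant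
component `1`, hence every group element, is a unit. -/
def IsBarycenter {d k N : ℕ} (x : Fin N → TensorSeq d k) (m : TensorSeq d k) : Prop :=
  m ∈ freeNilGroup d k ∧ ∑ i, tlog (Ring.inverse m * x i) = 0

open Classical in
/-- The barycenter of a sample (with the value `0`, which is not a group element, for a sample
that has no barycenter). -/
def bary {d k N : ℕ} (x : Fin N → TensorSeq d k) : TensorSeq d k :=
  if h : ∃ m, IsBarycenter x m then h.choose else 0

/-! ### Signatures of piecewise linear paths -/

/-- The entry of the iterated-integrals signature of the path `X : [0,1] → ℝ^d` at the word
`w₁ … w_ℓ`, that is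
`∫₀¹ ∫₀^{t_ℓ} ⋯ ∫₀^{t₂} X'_{w₁}(t₁) ⋯ X'_{w_ℓ}(t_ℓ) dt₁ ⋯ dt_ℓ`, which is `1` for the empty
word. The fold integrates over `t₁` first and over `t_ℓ` last. -/
def sigEntry {d : ℕ} (X : ℝ → Fin d → ℝ) (w : List (Fin d)) : ℝ :=
  w.foldl (fun (F : ℝ → ℝ) (a : Fin d) (T : ℝ) =>
    ∫ t in (0 : ℝ)..T, F t * deriv (fun s => X s a) t) (fun _ => 1) 1

/-- The `k`-truncated signature of a path. -/
def signature {d : ℕ} (k : ℕ) (X : ℝ → Fin d → ℝ) : TensorSeq d k := fun w => sigEntry X w.1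

/-- `X`, restricted to `[0,1]`, is a piecewise linear path with `m` segments that starts at the
origin. (Segments may be constant, and consecutive segments may be collinear. Values of `X`
outside `[0,1]` play no role.) -/
def IsPiecewiseLinear {d : ℕ} (m : ℕ) (X : ℝ → Fin d → ℝ) : Prop :=
  X 0 = 0 ∧ ∃ t : Fin (m + 1) → ℝ, StrictMono t ∧ t 0 = 0 ∧ t (Fin.last m) = 1 ∧
    ∀ i : Fin m, ∃ v : Fin d → ℝ, ∀ s ∈ Set.Icc (t i.castSucc) (t i.succ),
      X s = X (t i.castSucc) + (s - t i.castSucc) • v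

/-- The set of all `k`-truncated signatures of piecewise linear paths in `ℝ^d` with `m`
segments. -/
def plSignatures (d k m : ℕ) : Set (TensorSeq d k) :=
  {s | ∃ X : ℝ → Fin d → ℝ, IsPiecewiseLinear m X ∧ signature k X = s}

/-! ### The barycenter recovery order -/

/-- The positive integers `m` such that every barycenter of signatures of piecewise linear
paths with `α₁, …, α_N` segments is the signature of a piecewise linear path with `m`
segments. -/
def recoverySet (d k : ℕ) {N : ℕ} (α : Fin N → ℕ) : Set ℕ :=
  {m | 1 ≤ m ∧
    bary '' Set.univ.pi (fun i => plSignatures d k (α i)) ⊆ plSignatures d k m}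

/-- The barycenter recovery order `B_{d,k}(α)`. -/
def baryOrder (d k : ℕ) {N : ℕ} (α : Fin N → ℕ) : ℕ := sInf (recoverySet d k α)

end BarySig

end

/-! Everything is an induction along the filtration of `TensorSeq d k` by level: `filt d k l` is
multiplicative and `filt d k (k + 1)` is zero, so an object determined to leading order at each
level is determined. To leading order `texp z` is `1 + z`, and `tlog s - tlog t` is `s - t`
(`tlog_sub_tlog_mem`).

That the exponentials of Lie elements form a group is proved without the Baker–Campbell–Hausdorff
formula. Let `D` be the derivation multiplying a tensor by its level. For `g = exp z` the
logarithmic derivative `g⁻¹ D g` is a series in iterated brackets of `D z` with `z`, with leading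
term `D z`; since `D` is bijective on the Lie algebra, `z` is a Lie element exactly when `g⁻¹ D g`
is. Logarithmic derivatives of products are controlled by `(gh)⁻¹ D(gh) = h⁻¹ (g⁻¹ D g) h + h⁻¹ D
h`, which gives `mul_mem_freeNilGroup`.

A barycenter is found by Newton-like corrections: multiplying `m` on the right by the exponential of
the mean logarithm removes the leading term of the sum. Uniqueness is the same computation for the
difference of two solutions.

By Chen's identity, signatures of paths with `m` segments are the products of `m` exponentials of
vectors, hence group elements. Conversely, group commutators of such products realize nested
brackets to leading order with a number of factors independent of the coefficient, so clearing one
level after another writes every group element with a uniformly bounded number of factors. A single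
`m` therefore captures the whole group, in particular all barycenters. -/

noncomputable section

namespace BarySig

open Finset

variable {d k N : ℕ}

/-! ### The filtration by level -/

/-- The tensor sequences that vanish below level `l`. -/
def filt (d k l : ℕ) : Submodule ℝ (TensorSeq d k) where
  carrier := {a | ∀ w : Word d k, w.1.length < l → a w = 0}
  add_mem' ha hb w hw := by simp [ha w hw, hb w hw]
  zero_mem' w _ := rfl
  smul_mem' r a ha w hw := by simp [ha w hw]

theorem filt_anti {l m : ℕ} (h : l ≤ m) : filt d k m ≤ filt d k l :=
  fun _ ha w hw => ha w (hw.trans_le h)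

theorem mem_filt_zero (a : TensorSeq d k) : a ∈ filt d k 0 := fun _ hw => by simp at hw

theorem eq_zero_of_mem_filt {l : ℕ} (hl : k < l) {a : TensorSeq d k} (ha : a ∈ filt d k l) :
    a = 0 := by
  ext w
  exact ha w (w.2.trans_lt hl)

theorem mul_mem_filt {l m : ℕ} {a b : TensorSeq d k} (ha : a ∈ filt d k l)
    (hb : b ∈ filt d k m) : a * b ∈ filt d k (l + m) := by
  intro w hw
  rw [TensorSeq.mul_apply]
  refine sum_eq_zero fun i hi => ?_
  rw [mem_range] at hi
  by_cases h : i < l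
  · rw [ha, zero_mul]
    simp only [Word.take, List.length_take]
    omega
  · rw [hb, mul_zero]
    simp only [Word.drop, List.length_drop]
    omega

theorem mul_mem_filt_left {l : ℕ} {a : TensorSeq d k} (ha : a ∈ filt d k l)
    (b : TensorSeq d k) : a * b ∈ filt d k l := by
  simpa using mul_mem_filt ha (mem_filt_zero b)

theorem mul_mem_filt_right {l : ℕ} {a : TensorSeq d k} (b : TensorSeq d k)
    (ha : a ∈ filt d k l) : b * a ∈ filt d k l := by
  simpa using mul_mem_filt (mem_filt_zero b) ha

theorem pow_mem_filt {l : ℕ} {a : TensorSeq d k} (ha : a ∈ filt d k l) (n : ℕ) :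
    a ^ n ∈ filt d k (n * l) := by
  induction n with
  | zero => simpa using mem_filt_zero _
  | succ n ih => rw [pow_succ, Nat.succ_mul]; exact mul_mem_filt ih ha

theorem pow_eq_zero_of_mem_filt {a : TensorSeq d k} (ha : a ∈ filt d k 1) {n : ℕ} (hn : k < n) :
    a ^ n = 0 :=
  eq_zero_of_mem_filt (by simpa using hn) (pow_mem_filt ha n)

/-- The bracket raises the filtration. -/
theorem lie_mem_filt {l m : ℕ} {a b : TensorSeq d k} (ha : a ∈ filt d k l)
    (hb : b ∈ filt d k m) : ⁅a, b⁆ ∈ filt d k (l + m) := by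
  rw [Ring.lie_def]
  exact sub_mem (mul_mem_filt ha hb) (add_comm l m ▸ mul_mem_filt hb ha)

/-! ### First order behaviour of the exponential and the logarithm -/

theorem texp_eq_sum {z : TensorSeq d k} (hz : z ∈ filt d k 1) {n : ℕ} (hn : k < n) :
    texp z = ∑ i ∈ range n, ((i.factorial : ℝ)⁻¹) • z ^ i := by
  rw [texp]
  refine sum_subset (range_subset_range.2 hn) fun i _ hi => ?_
  rw [pow_eq_zero_of_mem_filt hz (by simpa using hi), smul_zero]

theorem tlog_eq_sum {s : TensorSeq d k} (hs : s - 1 ∈ filt d k 1) {n : ℕ} (hn : k ≤ n) :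
    tlog s = ∑ l ∈ Icc 1 n, ((-1 : ℝ) ^ (l + 1) / (l : ℝ)) • (s - 1) ^ l := by
  rw [tlog]
  refine sum_subset (Icc_subset_Icc le_rfl hn) fun i hi hi' => ?_
  rw [mem_Icc] at hi hi'
  rw [pow_eq_zero_of_mem_filt hs (by omega), smul_zero]

theorem texp_zero : texp (0 : TensorSeq d k) = 1 := by
  rw [texp, sum_range_succ']
  simp

theorem texp_sub_one_sub_mem {l : ℕ} (hl : 1 ≤ l) {z : TensorSeq d k} (hz : z ∈ filt d k l) :
    texp z - 1 - z ∈ filt d k (l + 1) := by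
  -- Summing over `range (k + 2)` makes the linear term present even for `k = 0`.
  rw [texp_eq_sum (filt_anti hl hz) (n := k + 2) (by omega), sum_range_succ', sum_range_succ']
  have h : ∀ x : TensorSeq d k, x + ((0 + 1).factorial : ℝ)⁻¹ • z ^ (0 + 1) +
      ((Nat.factorial 0 : ℝ)⁻¹) • z ^ 0 - 1 - z = x := fun x => by simp
  rw [h]
  refine sum_mem fun i _ => Submodule.smul_mem _ _ ?_
  rw [pow_add, pow_add, pow_one, mul_assoc]
  exact mul_mem_filt_right _ (filt_anti (by omega) (mul_mem_filt hz hz))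

theorem texp_sub_one_mem {l : ℕ} (hl : 1 ≤ l) {z : TensorSeq d k} (hz : z ∈ filt d k l) :
    texp z - 1 ∈ filt d k l := by
  have := add_mem (filt_anti (Nat.le_succ l) (texp_sub_one_sub_mem hl hz)) hz
  simpa using this

/-- Telescoping puts a factor `a - b` into each summand; for exponents at least two it comes with a
further factor of positive level, which gains one level. -/
theorem pow_sub_pow_mem_filt {l : ℕ} {a b : TensorSeq d k} (ha : a ∈ filt d k 1)
    (hb : b ∈ filt d k 1) (hab : a - b ∈ filt d k l) (n : ℕ) :
    a ^ (n + 2) - b ^ (n + 2) ∈ filt d k (l + 1) := by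
  have key : ∀ n, a ^ (n + 1) - b ^ (n + 1) ∈ filt d k l := by
    intro n
    induction n with
    | zero => simpa using hab
    | succ n ih =>
      have : a ^ (n + 1 + 1) - b ^ (n + 1 + 1) =
          a ^ (n + 1) * (a - b) + (a ^ (n + 1) - b ^ (n + 1)) * b := by
        rw [pow_succ a (n + 1), pow_succ b (n + 1)]; noncomm_ring
      rw [this]
      exact add_mem (mul_mem_filt_right _ hab) (mul_mem_filt_left ih _)
  have : a ^ (n + 2) - b ^ (n + 2) =
      a ^ n * (a * (a - b)) + (a ^ (n + 1) - b ^ (n + 1)) * b := by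
    rw [pow_succ a (n + 1), pow_succ b (n + 1), pow_succ a n]; noncomm_ring
  rw [this]
  exact add_mem (mul_mem_filt_right _ (add_comm l 1 ▸ mul_mem_filt ha hab))
    (mul_mem_filt (key n) hb)

/-- Only the linear term of the series matters to leading order, by `pow_sub_pow_mem_filt`. This
drives injectivity of the logarithm and both halves of the barycenter argument. -/
theorem tlog_sub_tlog_mem {l : ℕ} {s t : TensorSeq d k} (hs : s - 1 ∈ filt d k 1)
    (ht : t - 1 ∈ filt d k 1) (hst : s - t ∈ filt d k l) :
    tlog s - tlog t - (s - t) ∈ filt d k (l + 1) := by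
  -- The upper limit `k + 1` makes the linear term available even for `k = 0`.
  rw [tlog_eq_sum hs (Nat.le_succ k), tlog_eq_sum ht (Nat.le_succ k), ← sum_sub_distrib,
    ← Finset.add_sum_Ioc_eq_sum_Icc (by omega)]
  have h : ∀ x : TensorSeq d k, ((-1 : ℝ) ^ (1 + 1) / ((1 : ℕ) : ℝ)) • (s - 1) ^ 1 -
      ((-1 : ℝ) ^ (1 + 1) / ((1 : ℕ) : ℝ)) • (t - 1) ^ 1 + x - (s - t) = x := fun x => by
    simp
  rw [h]
  refine sum_mem fun i hi => ?_
  rw [mem_Ioc] at hi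
  obtain ⟨j, rfl⟩ := Nat.exists_eq_add_of_le' (Nat.succ_le_of_lt hi.1)
  rw [← smul_sub]
  exact Submodule.smul_mem _ _ (pow_sub_pow_mem_filt hs ht (by simpa using hst) j)

theorem tlog_mem_filt {l : ℕ} {s : TensorSeq d k} (hs : s - 1 ∈ filt d k l) :
    tlog s ∈ filt d k l := by
  refine sum_mem fun i hi => Submodule.smul_mem _ _ ?_
  obtain ⟨j, rfl⟩ := Nat.exists_eq_add_of_le' (mem_Icc.1 hi).1
  rw [pow_succ]
  exact mul_mem_filt_right _ hs

/-! ### The exponential and the logarithm are mutually inverse -/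

theorem sub_mem_filt_of_tlog_eq {s t : TensorSeq d k} (hs : s - 1 ∈ filt d k 1)
    (ht : t - 1 ∈ filt d k 1) (h : tlog s = tlog t) (l : ℕ) : s - t ∈ filt d k l := by
  induction l with
  | zero => exact mem_filt_zero _
  | succ l ih =>
    have := tlog_sub_tlog_mem hs ht ih
    rw [h, sub_self, zero_sub] at this
    simpa using neg_mem this

theorem tlog_injOn : Set.InjOn (tlog (d := d) (k := k)) {s | s - 1 ∈ filt d k 1} :=
  fun _ hs _ ht h => sub_eq_zero.1
    (eq_zero_of_mem_filt (Nat.lt_succ_self k) (sub_mem_filt_of_tlog_eq hs ht h (k + 1)))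

open Polynomial in
/-- The truncated logarithm series composed with the truncated exponential series. -/
theorem X_pow_dvd_log_exp_sub_X (k : ℕ) :
    (X : ℝ[X]) ^ (k + 1) ∣
      ∑ l ∈ Icc 1 k, C ((-1 : ℝ) ^ (l + 1) / (l : ℝ)) *
        (∑ i ∈ range (k + 1), C ((i.factorial : ℝ)⁻¹) * X ^ i - 1) ^ l - X := by
  set E : ℝ[X] := ∑ i ∈ range (k + 1), C ((i.factorial : ℝ)⁻¹) * X ^ i with hE
  have hu : X ∣ E - 1 := by
    rw [X_dvd_iff, coeff_sub, hE, sum_range_succ', coeff_add]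
    simp
  -- The truncated exponential is its own derivative up to its top term.
  have hE' : derivative E = E - C ((k.factorial : ℝ)⁻¹) * X ^ k := by
    have h1 : derivative E = ∑ i ∈ range k, C ((i.factorial : ℝ)⁻¹) * X ^ i := by
      rw [hE, derivative_sum, sum_range_succ']
      simp only [derivative_mul, derivative_C, zero_mul, zero_add, derivative_X_pow, pow_zero,
        derivative_one, mul_zero, add_zero]
      refine sum_congr rfl fun i _ => ?_
      rw [← mul_assoc, ← C_mul, Nat.add_sub_cancel, Nat.factorial_succ]
      congr 2
      push_cast
      field_simp
    rw [h1, hE, sum_range_succ]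
    ring
  have hgeom : ∀ u : ℝ[X], (∑ l ∈ Icc 1 k, (-1) ^ (l + 1) * u ^ (l - 1)) * (1 + u) =
      1 - (-u) ^ k := by
    intro u
    have : ∑ l ∈ Icc 1 k, (-1) ^ (l + 1) * u ^ (l - 1) = ∑ i ∈ range k, (-u) ^ i := by
      rw [range_eq_Ico, sum_Ico_eq_sum_range, ← Finset.Ico_succ_right_eq_Icc,
        sum_Ico_eq_sum_range]
      refine sum_congr (by simp) fun i _ => ?_
      rw [neg_pow u, zero_add, add_tsub_cancel_left, pow_add, pow_add]
      norm_num
    rw [this, ← geom_sum_mul_neg, sub_neg_eq_add]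
  set P : ℝ[X] := ∑ l ∈ Icc 1 k, C ((-1 : ℝ) ^ (l + 1) / (l : ℝ)) * (E - 1) ^ l with hP
  have hP' : derivative P =
      (∑ l ∈ Icc 1 k, (-1) ^ (l + 1) * (E - 1) ^ (l - 1)) * derivative E := by
    rw [hP, derivative_sum, sum_mul]
    refine sum_congr rfl fun l hl => ?_
    have hl0 : (l : ℝ) ≠ 0 := by
      have := (mem_Icc.1 hl).1
      positivity
    rw [derivative_mul, derivative_C, zero_mul, zero_add, derivative_pow, derivative_sub,
      derivative_one, sub_zero, ← mul_assoc, ← mul_assoc, ← C_mul, div_mul_cancel₀ _ hl0]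
    simp
  -- With `u = E - 1`, the truncated geometric series times `1 + u = E` is `1 - (-u) ^ k`, and `X`
  -- divides `u`. Together with the vanishing constant term below, this gives divisibility by `X ^
  -- (k + 1)`.
  have hd : X ^ k ∣ derivative (P - X) := by
    have h2 := hgeom (E - 1)
    rw [add_sub_cancel] at h2
    have h3 : derivative (P - X) = -(-(E - 1)) ^ k -
        (∑ l ∈ Icc 1 k, (-1) ^ (l + 1) * (E - 1) ^ (l - 1)) *
          C ((k.factorial : ℝ)⁻¹) * X ^ k := by
      rw [derivative_sub, hP', hE', mul_sub, h2, derivative_X]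
      ring
    rw [h3]
    exact dvd_sub ((pow_dvd_pow_of_dvd (hu.neg_right) k).neg_right) (Dvd.intro_left _ rfl)
  have h0 : coeff (P - X) 0 = 0 := by
    have : X ∣ P - X := by
      refine dvd_sub (dvd_sum fun l hl => ?_) dvd_rfl
      exact (hu.trans (dvd_pow_self _ (by have := (mem_Icc.1 hl).1; omega))).mul_left _
    exact X_dvd_iff.1 this
  rw [X_pow_dvd_iff]
  intro i hi
  rcases i with _ | i
  · exact h0
  · have := X_pow_dvd_iff.1 hd i (by omega)
    rw [coeff_derivative] at this
    exact (mul_eq_zero.1 this).resolve_right (by positivity)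

/-- The polynomial congruence is evaluated at `z`, where `X ^ (k + 1)` becomes zero. -/
theorem tlog_texp {z : TensorSeq d k} (hz : z ∈ filt d k 1) : tlog (texp z) = z := by
  obtain ⟨q, hq⟩ := X_pow_dvd_log_exp_sub_X k
  have h := congrArg (Polynomial.aeval z) hq
  simp only [map_sub, map_mul, map_pow, map_sum, Polynomial.aeval_C, Polynomial.aeval_X, map_one,
    ← Algebra.smul_def] at h
  rw [pow_eq_zero_of_mem_filt hz (Nat.lt_succ_self k), zero_mul, sub_eq_zero] at h
  exact h

/-- No second power series identity is needed: both sides have the same logarithm, and the logarithm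
is injective. -/
theorem texp_tlog {s : TensorSeq d k} (hs : s - 1 ∈ filt d k 1) : texp (tlog s) = s := by
  have h := tlog_mem_filt hs
  exact tlog_injOn (texp_sub_one_mem le_rfl h) hs (tlog_texp h)

/-! ### Conjugation by an exponential -/

section Conjugation

variable {A : Type*} [Ring A] [Algebra ℝ A]

/-- The operator `y ↦ ⁅y, z⁆`. -/
def rightAd (z : A) : Module.End ℝ A := LinearMap.mulRight ℝ z + LinearMap.mulLeft ℝ (-z)

theorem rightAd_apply (z y : A) : rightAd z y = y * z - z * y := by
  simp [rightAd, sub_eq_add_neg]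

variable [Module ℚ A]

theorem exp_mulLeft {z : A} {n : ℕ} (hz : z ^ n = 0) :
    IsNilpotent.exp (LinearMap.mulLeft ℝ z) = LinearMap.mulLeft ℝ (IsNilpotent.exp z) := by
  have h : LinearMap.mulLeft ℝ z ^ n = 0 := by
    rw [LinearMap.pow_mulLeft, hz, LinearMap.mulLeft_zero_eq_zero]
  rw [IsNilpotent.exp_eq_sum h, IsNilpotent.exp_eq_sum hz]
  ext y
  simp [LinearMap.pow_mulLeft, sum_mul, LinearMap.sum_apply, ← Rat.cast_smul_eq_qsmul ℝ]

theorem exp_mulRight {z : A} {n : ℕ} (hz : z ^ n = 0) :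
    IsNilpotent.exp (LinearMap.mulRight ℝ z) = LinearMap.mulRight ℝ (IsNilpotent.exp z) := by
  have h : LinearMap.mulRight ℝ z ^ n = 0 := by
    rw [LinearMap.pow_mulRight, hz, LinearMap.mulRight_zero_eq_zero]
  rw [IsNilpotent.exp_eq_sum h, IsNilpotent.exp_eq_sum hz]
  ext y
  simp [LinearMap.pow_mulRight, mul_sum, LinearMap.sum_apply, ← Rat.cast_smul_eq_qsmul ℝ]

/-- Right multiplication by `z` and left multiplication by `-z` commute, so the exponential of their
sum `rightAd z` is the product of their exponentials. -/
theorem exp_neg_mul_mul_exp {z : A} {n : ℕ} (hz : z ^ n = 0) (y : A) :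
    IsNilpotent.exp (-z) * y * IsNilpotent.exp z =
      ∑ i ∈ range (n + n), ((i.factorial : ℝ)⁻¹) • (rightAd z ^ i) y := by
  have hz' : (-z) ^ n = 0 := by rw [neg_pow, hz, mul_zero]
  have hR : LinearMap.mulRight ℝ z ^ n = 0 := by
    rw [LinearMap.pow_mulRight, hz, LinearMap.mulRight_zero_eq_zero]
  have hL : LinearMap.mulLeft ℝ (-z) ^ n = 0 := by
    rw [LinearMap.pow_mulLeft, hz', LinearMap.mulLeft_zero_eq_zero]
  have hc : Commute (LinearMap.mulRight ℝ z) (LinearMap.mulLeft ℝ (-z)) :=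
    (LinearMap.commute_mulLeft_right (R := ℝ) (-z) z).symm
  have hn : rightAd z ^ (n + n) = 0 :=
    hc.add_pow_eq_zero_of_add_le_succ_of_pow_eq_zero hR hL (Nat.le_succ _)
  have h := IsNilpotent.exp_add_of_commute hc ⟨n, hR⟩ ⟨n, hL⟩
  have h' := congrArg (fun f : Module.End ℝ A => f y) h
  rw [exp_mulLeft hz', exp_mulRight hz] at h'
  change IsNilpotent.exp (rightAd z) y = _ at h'
  rw [IsNilpotent.exp_eq_sum hn] at h'
  simpa [LinearMap.sum_apply, ← Rat.cast_smul_eq_qsmul ℝ] using h'.symm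

end Conjugation

/-- `IsNilpotent.exp` is formed with rational scalars. -/
instance : Module ℚ (TensorSeq d k) := Module.compHom _ (algebraMap ℚ ℝ)

theorem texp_eq_exp {z : TensorSeq d k} (hz : z ∈ filt d k 1) : texp z = IsNilpotent.exp z := by
  rw [IsNilpotent.exp_eq_sum (pow_eq_zero_of_mem_filt hz (Nat.lt_succ_self k)), texp]
  simp [← Rat.cast_smul_eq_qsmul ℝ]

theorem texp_neg_mul_texp {z : TensorSeq d k} (hz : z ∈ filt d k 1) :
    texp (-z) * texp z = 1 := by
  rw [texp_eq_exp hz, texp_eq_exp (neg_mem hz), IsNilpotent.exp_neg_mul_exp_self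
    ⟨_, pow_eq_zero_of_mem_filt hz (Nat.lt_succ_self k)⟩]

theorem texp_mul_texp_neg {z : TensorSeq d k} (hz : z ∈ filt d k 1) :
    texp z * texp (-z) = 1 := by
  simpa using texp_neg_mul_texp (neg_mem hz)

theorem texp_neg_mul_mul_texp {z : TensorSeq d k} (hz : z ∈ filt d k 1) (y : TensorSeq d k) :
    texp (-z) * y * texp z =
      ∑ i ∈ range (k + 1 + (k + 1)), ((i.factorial : ℝ)⁻¹) • (rightAd z ^ i) y := by
  rw [texp_eq_exp hz, texp_eq_exp (neg_mem hz),
    exp_neg_mul_mul_exp (pow_eq_zero_of_mem_filt hz (Nat.lt_succ_self k))]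

/-! ### The degree derivation -/

/-- The derivation that multiplies a tensor by its level. -/
def degDer (d k : ℕ) : Module.End ℝ (TensorSeq d k) where
  toFun a w := (w.1.length : ℝ) * a w
  map_add' a b := by ext w; exact mul_add _ _ _
  map_smul' r a := by ext w; exact mul_left_comm _ _ _

theorem degDer_apply (a : TensorSeq d k) (w : Word d k) :
    degDer d k a w = (w.1.length : ℝ) * a w := rfl

theorem degDer_mul (a b : TensorSeq d k) :
    degDer d k (a * b) = degDer d k a * b + a * degDer d k b := by
  ext w
  rw [degDer_apply, TensorSeq.add_apply, TensorSeq.mul_apply, TensorSeq.mul_apply,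
    TensorSeq.mul_apply, mul_sum, ← sum_add_distrib]
  refine sum_congr rfl fun i hi => ?_
  have hi' : i ≤ w.1.length := by simpa [Nat.lt_succ_iff] using hi
  have h : (w.1.length : ℝ) = (w.take i).1.length + (w.drop i).1.length := by
    rw [← Nat.cast_add]
    congr 1
    simp only [Word.take, Word.drop, List.length_take, List.length_drop]
    omega
  rw [degDer_apply, degDer_apply, h]
  ring

theorem degDer_lie (a b : TensorSeq d k) :
    degDer d k ⁅a, b⁆ = ⁅degDer d k a, b⁆ + ⁅a, degDer d k b⁆ := by
  simp only [Ring.lie_def, map_sub, degDer_mul]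
  abel

theorem degDer_one : degDer d k 1 = 0 := by
  simpa using degDer_mul (1 : TensorSeq d k) 1

theorem degDer_mem_filt {l : ℕ} {a : TensorSeq d k} (ha : a ∈ filt d k l) :
    degDer d k a ∈ filt d k l := fun w hw => by rw [degDer_apply, ha w hw, mul_zero]

/-- The derivation acts on each positive level by a nonzero scalar; only level zero is lost. -/
theorem mem_filt_of_degDer {l : ℕ} {a : TensorSeq d k} (ha : a ∈ filt d k 1)
    (h : degDer d k a ∈ filt d k l) : a ∈ filt d k l := by
  intro w hw
  have h1 := h w hw
  rw [degDer_apply] at h1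
  by_cases h0 : w.1.length = 0
  · exact ha w (by omega)
  · exact (mul_eq_zero.1 h1).resolve_left (Nat.cast_ne_zero.2 h0)

/-- The logarithmic derivative of an exponential. -/
theorem texp_neg_mul_degDer_texp {z : TensorSeq d k} (hz : z ∈ filt d k 1) :
    texp (-z) * degDer d k (texp z) =
      ∑ i ∈ range (k + (k + 1)),
        (((i + 1).factorial : ℝ)⁻¹) • (rightAd z ^ i) (degDer d k z) := by
  have hzn := pow_eq_zero_of_mem_filt hz (Nat.lt_succ_self k)
  have hzn' := pow_eq_zero_of_mem_filt (neg_mem hz) (Nat.lt_succ_self k)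
  have hLz : (LinearMap.mulLeft ℝ z) ^ (k + 1) = 0 := by
    rw [LinearMap.pow_mulLeft, hzn, LinearMap.mulLeft_zero_eq_zero]
  -- The conjugation formula is used in the endomorphism algebra, for left multiplication by `z` and
  -- the operator `degDer d k`, and evaluated at `1`.
  have h := congrArg (fun f : Module.End ℝ (TensorSeq d k) => f 1)
    (exp_neg_mul_mul_exp hLz (degDer d k))
  have hneg : -LinearMap.mulLeft ℝ z = LinearMap.mulLeft ℝ (-z) := by ext; simp
  -- By the Leibniz rule the commutator of `degDer` with left multiplication by `z` is left
  -- multiplication by `degDer d k z`. This uses up one bracket, hence the index shift; the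
  -- remaining term `i = 0` is `degDer d k 1 = 0`.
  have hstep : ∀ i, (rightAd (LinearMap.mulLeft ℝ z) ^ (i + 1)) (degDer d k) =
      LinearMap.mulLeft ℝ ((rightAd z ^ i) (degDer d k z)) := by
    intro i
    induction i with
    | zero =>
      refine LinearMap.ext fun x => ?_
      simp [rightAd_apply, degDer_mul]
    | succ i ih =>
      rw [pow_succ', Module.End.mul_apply, ih, pow_succ' (rightAd z), Module.End.mul_apply,
        rightAd_apply, rightAd_apply]
      refine LinearMap.ext fun x => ?_
      simp [sub_mul, mul_assoc]
  rw [hneg, exp_mulLeft hzn, exp_mulLeft hzn', ← texp_eq_exp hz, ← texp_eq_exp (neg_mem hz),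
    show k + 1 + (k + 1) = k + (k + 1) + 1 by ring, sum_range_succ'] at h
  simpa [hstep, LinearMap.sum_apply, degDer_one] using h

/-! ### The free nilpotent Lie algebra -/

theorem letter_mem_filt (i : Fin d) : letter d k i ∈ filt d k 1 := by
  intro w hw
  rw [letter, if_neg]
  intro h
  simp [h] at hw

theorem letter_mem_freeNilLie (i : Fin d) : letter d k i ∈ freeNilLie d k :=
  LieSubalgebra.subset_lieSpan ⟨i, rfl⟩

theorem freeNilLie_le_filt : (freeNilLie d k).toSubmodule ≤ filt d k 1 := by
  intro x hx
  refine LieSubalgebra.lieSpan_induction (R := ℝ) (p := fun x _ => x ∈ filt d k 1) ?_ ?_ ?_ ?_ ?_ hx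
  · rintro _ ⟨i, rfl⟩
    exact letter_mem_filt i
  · exact zero_mem _
  · exact fun _ _ _ _ => add_mem
  · exact fun r _ _ => Submodule.smul_mem _ r
  · exact fun _ _ _ _ hx hy => filt_anti one_le_two (lie_mem_filt hx hy)

theorem mem_filt_of_mem_freeNilLie {z : TensorSeq d k} (hz : z ∈ freeNilLie d k) :
    z ∈ filt d k 1 := freeNilLie_le_filt hz

theorem degDer_letter (i : Fin d) : degDer d k (letter d k i) = letter d k i := by
  ext w
  rw [degDer_apply, letter]
  split_ifs with h <;> simp [h]

theorem degDer_mem_freeNilLie {x : TensorSeq d k} (hx : x ∈ freeNilLie d k) :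
    degDer d k x ∈ freeNilLie d k := by
  refine LieSubalgebra.lieSpan_induction (R := ℝ)
    (p := fun x _ => degDer d k x ∈ freeNilLie d k) ?_ ?_ ?_ ?_ ?_ hx
  · rintro _ ⟨i, rfl⟩
    rw [degDer_letter]
    exact letter_mem_freeNilLie i
  · rw [map_zero]; exact zero_mem _
  · intro x y _ _ hx hy
    rw [map_add]; exact add_mem hx hy
  · intro r x _ hx
    rw [map_smul]; exact (freeNilLie d k).smul_mem r hx
  · intro x y hx hy hx' hy'
    rw [degDer_lie]
    exact add_mem (LieSubalgebra.lie_mem _ hx' hy) (LieSubalgebra.lie_mem _ hx hy')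

instance : Finite (Word d k) := (List.finite_length_le (Fin d) k).to_subtype

instance : Module.Finite ℝ (TensorSeq d k) := inferInstanceAs (Module.Finite ℝ (Word d k → ℝ))

/-- The degree derivation maps the free nilpotent Lie algebra onto itself. -/
theorem exists_degDer_eq {x : TensorSeq d k} (hx : x ∈ freeNilLie d k) :
    ∃ y ∈ freeNilLie d k, degDer d k y = x := by
  let f : Module.End ℝ (freeNilLie d k).toSubmodule :=
    (degDer d k).restrict fun _ h => degDer_mem_freeNilLie h
  have hf : Function.Injective f := by
    rw [← LinearMap.ker_eq_bot, LinearMap.ker_eq_bot']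
    rintro ⟨y, hy⟩ h
    have h' : degDer d k y = 0 := congrArg Subtype.val h
    refine Subtype.ext (eq_zero_of_mem_filt (Nat.lt_succ_self k)
      (mem_filt_of_degDer (freeNilLie_le_filt hy) ?_))
    rw [h']
    exact zero_mem _
  obtain ⟨⟨y, hy⟩, h⟩ := LinearMap.injective_iff_surjective.1 hf ⟨x, hx⟩
  exact ⟨y, hy, congrArg Subtype.val h⟩

theorem rightAd_pow_mem {z x : TensorSeq d k} (hz : z ∈ freeNilLie d k)
    (hx : x ∈ freeNilLie d k) (i : ℕ) : (rightAd z ^ i) x ∈ freeNilLie d k := by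
  induction i with
  | zero => exact hx
  | succ i ih =>
    rw [pow_succ', Module.End.mul_apply, rightAd_apply, ← Ring.lie_def]
    exact LieSubalgebra.lie_mem _ ih hz

theorem texp_neg_mul_mul_texp_mem {z y : TensorSeq d k} (hz : z ∈ freeNilLie d k)
    (hy : y ∈ freeNilLie d k) : texp (-z) * y * texp z ∈ freeNilLie d k := by
  rw [texp_neg_mul_mul_texp (mem_filt_of_mem_freeNilLie hz)]
  exact sum_mem fun i _ => (freeNilLie d k).smul_mem _ (rightAd_pow_mem hz hy i)

theorem texp_neg_mul_degDer_texp_mem {z : TensorSeq d k} (hz : z ∈ freeNilLie d k) :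
    texp (-z) * degDer d k (texp z) ∈ freeNilLie d k := by
  rw [texp_neg_mul_degDer_texp (mem_filt_of_mem_freeNilLie hz)]
  exact sum_mem fun i _ =>
    (freeNilLie d k).smul_mem _ (rightAd_pow_mem hz (degDer_mem_freeNilLie hz) i)

/-- An exponential whose logarithmic derivative is a Lie element is the exponential of a Lie
element. -/
theorem mem_freeNilLie_of_texp_neg_mul_degDer_texp_mem {z : TensorSeq d k}
    (hz : z ∈ filt d k 1) (h : texp (-z) * degDer d k (texp z) ∈ freeNilLie d k) :
    z ∈ freeNilLie d k := by
  rw [texp_neg_mul_degDer_texp hz] at h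
  -- Lie elements approximate `z` to every order. The series is solved for its leading term `degDer
  -- d k z`; the other terms contain a bracket, so replacing `z` by `y` in them gains a level.
  have key : ∀ l, ∃ y ∈ freeNilLie d k, z - y ∈ filt d k l := by
    intro l
    induction l with
    | zero => exact ⟨0, zero_mem _, mem_filt_zero _⟩
    | succ l ih =>
      obtain ⟨y, hy, hzy⟩ := ih
      have hstep : ∀ i, (rightAd z ^ (i + 1)) (degDer d k z) -
          (rightAd y ^ (i + 1)) (degDer d k y) ∈ filt d k (l + 1) := by
        have hd : degDer d k z - degDer d k y ∈ filt d k l := by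
          rw [← map_sub]; exact degDer_mem_filt hzy
        have gen : ∀ a b : TensorSeq d k, a ∈ filt d k 1 → a - b ∈ filt d k l →
            rightAd z a - rightAd y b ∈ filt d k (l + 1) := by
          intro a b ha hab
          have : rightAd z a - rightAd y b = ⁅a, z - y⁆ + ⁅a - b, y⁆ := by
            rw [rightAd_apply, rightAd_apply, Ring.lie_def, Ring.lie_def]
            noncomm_ring
          rw [this]
          exact add_mem (add_comm 1 l ▸ lie_mem_filt ha hzy)
            (lie_mem_filt hab (mem_filt_of_mem_freeNilLie hy))
        have hmem : ∀ i, (rightAd z ^ i) (degDer d k z) ∈ filt d k 1 := by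
          intro i
          induction i with
          | zero => exact degDer_mem_filt hz
          | succ i ih =>
            rw [pow_succ', Module.End.mul_apply, rightAd_apply, ← Ring.lie_def]
            exact filt_anti one_le_two (lie_mem_filt ih hz)
        intro i
        induction i with
        | zero => simpa using gen _ _ (degDer_mem_filt hz) hd
        | succ i ih =>
          rw [pow_succ', pow_succ' (rightAd y), Module.End.mul_apply, Module.End.mul_apply]
          exact gen _ _ (hmem _) (filt_anti (Nat.le_succ l) ih)
      obtain ⟨n, hn⟩ : ∃ n, k + (k + 1) = n + 1 := ⟨k + k, rfl⟩
      set c := ∑ i ∈ range (k + (k + 1)),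
        (((i + 1).factorial : ℝ)⁻¹) • (rightAd z ^ i) (degDer d k z) with hc
      set r := ∑ i ∈ range n,
        (((i + 1 + 1).factorial : ℝ)⁻¹) • (rightAd y ^ (i + 1)) (degDer d k y) with hr
      have hrmem : r ∈ freeNilLie d k := sum_mem fun i _ =>
        (freeNilLie d k).smul_mem _ (rightAd_pow_mem hy (degDer_mem_freeNilLie hy) _)
      -- The next approximation solves `degDer d k u = c - r`, with `r` the higher terms evaluated
      -- at `y`.
      obtain ⟨u, hu, hu'⟩ := exists_degDer_eq (sub_mem h hrmem)
      refine ⟨u, hu, mem_filt_of_degDer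
        (sub_mem hz (mem_filt_of_mem_freeNilLie hu)) ?_⟩
      have : degDer d k (z - u) = -∑ i ∈ range n, (((i + 1 + 1).factorial : ℝ)⁻¹) •
          ((rightAd z ^ (i + 1)) (degDer d k z) - (rightAd y ^ (i + 1)) (degDer d k y)) := by
        rw [map_sub, hu', hc, hn, sum_range_succ', hr]
        simp only [smul_sub, sum_sub_distrib]
        simp
        abel
      rw [this]
      exact neg_mem (sum_mem fun i _ => Submodule.smul_mem _ _ (hstep i))
  obtain ⟨y, hy, hzy⟩ := key (k + 1)
  rwa [sub_eq_zero.1 (eq_zero_of_mem_filt (Nat.lt_succ_self k) hzy)]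

/-! ### The free nilpotent group -/

theorem texp_mem_freeNilGroup {z : TensorSeq d k} (hz : z ∈ freeNilLie d k) :
    texp z ∈ freeNilGroup d k := ⟨z, hz, rfl⟩

theorem sub_one_mem_filt_of_mem_freeNilGroup {g : TensorSeq d k} (hg : g ∈ freeNilGroup d k) :
    g - 1 ∈ filt d k 1 := by
  obtain ⟨z, hz, rfl⟩ := hg
  exact texp_sub_one_mem le_rfl (mem_filt_of_mem_freeNilLie hz)

theorem one_mem_freeNilGroup : (1 : TensorSeq d k) ∈ freeNilGroup d k :=
  ⟨0, zero_mem _, texp_zero⟩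

theorem tlog_mem_freeNilLie {g : TensorSeq d k} (hg : g ∈ freeNilGroup d k) :
    tlog g ∈ freeNilLie d k := by
  obtain ⟨z, hz, rfl⟩ := hg
  rwa [tlog_texp (mem_filt_of_mem_freeNilLie hz)]

theorem isUnit_texp {z : TensorSeq d k} (hz : z ∈ filt d k 1) : IsUnit (texp z) :=
  ⟨⟨texp z, texp (-z), texp_mul_texp_neg hz, texp_neg_mul_texp hz⟩, rfl⟩

theorem inverse_texp {z : TensorSeq d k} (hz : z ∈ filt d k 1) :
    Ring.inverse (texp z) = texp (-z) := by
  have h := Ring.inverse_mul_cancel_left (texp z) (texp (-z)) (isUnit_texp hz)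
  rwa [texp_mul_texp_neg hz, mul_one] at h

theorem isUnit_of_mem_freeNilGroup {g : TensorSeq d k} (hg : g ∈ freeNilGroup d k) :
    IsUnit g := by
  obtain ⟨z, hz, rfl⟩ := hg
  exact isUnit_texp (mem_filt_of_mem_freeNilLie hz)

theorem inverse_mem_freeNilGroup {g : TensorSeq d k} (hg : g ∈ freeNilGroup d k) :
    Ring.inverse g ∈ freeNilGroup d k := by
  obtain ⟨z, hz, rfl⟩ := hg
  rw [inverse_texp (mem_filt_of_mem_freeNilLie hz)]
  exact texp_mem_freeNilGroup (neg_mem hz)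

/-- By the product rule the logarithmic derivative of `g * h` is that of `g` conjugated by `h`, plus
that of `h`. Both are Lie elements, and this property characterizes exponentials of Lie elements. -/
theorem mul_mem_freeNilGroup {g h : TensorSeq d k} (hg : g ∈ freeNilGroup d k)
    (hh : h ∈ freeNilGroup d k) : g * h ∈ freeNilGroup d k := by
  have hg1 := sub_one_mem_filt_of_mem_freeNilGroup hg
  have hh1 := sub_one_mem_filt_of_mem_freeNilGroup hh
  have hgh : g * h - 1 ∈ filt d k 1 := by
    have : g * h - 1 = (g - 1) * h + (h - 1) := by noncomm_ring
    rw [this]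
    exact add_mem (mul_mem_filt_left hg1 _) hh1
  have hlog := tlog_mem_filt hgh
  refine ⟨tlog (g * h), mem_freeNilLie_of_texp_neg_mul_degDer_texp_mem hlog ?_, texp_tlog hgh⟩
  rw [← inverse_texp hlog, texp_tlog hgh,
    Ring.inverse_mul (Or.inl (isUnit_of_mem_freeNilGroup hg))]
  obtain ⟨x, hx, rfl⟩ := hg
  obtain ⟨y, hy, rfl⟩ := hh
  have hx1 := mem_filt_of_mem_freeNilLie hx
  have hy1 := mem_filt_of_mem_freeNilLie hy
  rw [inverse_texp hx1, inverse_texp hy1, degDer_mul]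
  have : texp (-y) * texp (-x) *
      (degDer d k (texp x) * texp y + texp x * degDer d k (texp y)) =
      texp (-y) * (texp (-x) * degDer d k (texp x)) * texp y +
        texp (-y) * (texp (-x) * texp x) * degDer d k (texp y) := by noncomm_ring
  rw [this, texp_neg_mul_texp hx1, mul_one]
  exact add_mem (texp_neg_mul_mul_texp_mem hy (texp_neg_mul_degDer_texp_mem hx))
    (texp_neg_mul_degDer_texp_mem hy)

/-! ### Existence and uniqueness of the barycenter -/

theorem inverse_mul_mem_freeNilGroup {g h : TensorSeq d k} (hg : g ∈ freeNilGroup d k)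
    (hh : h ∈ freeNilGroup d k) : Ring.inverse g * h ∈ freeNilGroup d k :=
  mul_mem_freeNilGroup (inverse_mem_freeNilGroup hg) hh

/-- Passing from `m` to `m * texp u` changes each logarithm by `-u` to leading order. With `u` the
mean of the logarithms, the sum loses its leading term. -/
theorem exists_sum_tlog_mem_filt (hN : 1 ≤ N) {x : Fin N → TensorSeq d k}
    (hx : ∀ i, x i ∈ freeNilGroup d k) (l : ℕ) :
    ∃ m ∈ freeNilGroup d k, ∑ i, tlog (Ring.inverse m * x i) ∈ filt d k (l + 1) := by
  induction l with
  | zero =>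
    exact ⟨1, one_mem_freeNilGroup, sum_mem fun i _ => mem_filt_of_mem_freeNilLie
      (tlog_mem_freeNilLie (inverse_mul_mem_freeNilGroup one_mem_freeNilGroup (hx i)))⟩
  | succ l ih =>
    obtain ⟨m, hm, hF⟩ := ih
    have hs : ∀ i, Ring.inverse m * x i ∈ freeNilGroup d k := fun i =>
      inverse_mul_mem_freeNilGroup hm (hx i)
    set F := ∑ i, tlog (Ring.inverse m * x i) with hFdef
    set u : TensorSeq d k := (N : ℝ)⁻¹ • F with hu
    have hug : u ∈ freeNilLie d k :=
      (freeNilLie d k).smul_mem _ (sum_mem fun i _ => tlog_mem_freeNilLie (hs i))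
    have hul : u ∈ filt d k (l + 1) := Submodule.smul_mem _ _ hF
    have hue := texp_mem_freeNilGroup hug
    have hnue := texp_mem_freeNilGroup (neg_mem hug)
    refine ⟨m * texp u, mul_mem_freeNilGroup hm hue, ?_⟩
    have hinv : ∀ i, Ring.inverse (m * texp u) * x i = texp (-u) * (Ring.inverse m * x i) := by
      intro i
      rw [Ring.inverse_mul (Or.inl (isUnit_of_mem_freeNilGroup hm)),
        inverse_texp (mem_filt_of_mem_freeNilLie hug), mul_assoc]
    have hterm : ∀ i, tlog (Ring.inverse (m * texp u) * x i) -
        tlog (Ring.inverse m * x i) + u ∈ filt d k (l + 1 + 1) := by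
      intro i
      rw [hinv]
      set s := Ring.inverse m * x i
      have h1 := sub_one_mem_filt_of_mem_freeNilGroup (hs i)
      have h2 := sub_one_mem_filt_of_mem_freeNilGroup (mul_mem_freeNilGroup hnue (hs i))
      have h3 : texp (-u) - 1 ∈ filt d k (l + 1) :=
        texp_sub_one_mem (by omega) (neg_mem hul)
      have h4 : texp (-u) * s - s = (texp (-u) - 1) * s := by noncomm_ring
      have h5 := tlog_sub_tlog_mem h2 h1 (l := l + 1) (h4 ▸ mul_mem_filt_left h3 s)
      have h6 := texp_sub_one_sub_mem (l := l + 1) (by omega) (neg_mem hul)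
      have h7 := mul_mem_filt h3 h1
      have : tlog (texp (-u) * s) - tlog s + u =
          (tlog (texp (-u) * s) - tlog s - (texp (-u) * s - s)) + (texp (-u) - 1 - -u) +
            (texp (-u) - 1) * (s - 1) := by noncomm_ring
      rw [this]
      exact add_mem (add_mem h5 h6) h7
    have hsum := sum_mem (S := filt d k (l + 1 + 1)) (t := univ) fun i _ => hterm i
    have hNu : N • u = F := by
      have : (N : ℝ) ≠ 0 := by positivity
      rw [hu, ← Nat.cast_smul_eq_nsmul ℝ, smul_inv_smul₀ this]
    simpa [sum_add_distrib, hNu, ← hFdef] using hsum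

/-- To leading order each logarithm differs by `n - m`, so the difference of the two vanishing sums
is `N` times `n - m`, which must lie one level higher. -/
theorem sub_mem_filt_of_isBarycenter (hN : 1 ≤ N) {x : Fin N → TensorSeq d k}
    (hx : ∀ i, x i ∈ freeNilGroup d k) {m n : TensorSeq d k} (hm : IsBarycenter x m)
    (hn : IsBarycenter x n) (l : ℕ) : m - n ∈ filt d k l := by
  induction l with
  | zero => exact mem_filt_zero _
  | succ l ih =>
    have hm' := inverse_mem_freeNilGroup hm.1
    have hn' := inverse_mem_freeNilGroup hn.1
    have hm1 := sub_one_mem_filt_of_mem_freeNilGroup hm'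
    have hn1 := sub_one_mem_filt_of_mem_freeNilGroup hn'
    have hterm : ∀ i, tlog (Ring.inverse m * x i) - tlog (Ring.inverse n * x i) + (m - n) ∈
        filt d k (l + 1) := by
      intro i
      have hi1 := sub_one_mem_filt_of_mem_freeNilGroup (hx i)
      have hdiff : Ring.inverse m * x i - Ring.inverse n * x i =
          Ring.inverse n * (n - m) * Ring.inverse m * x i := by
        rw [mul_sub, sub_mul, sub_mul,
          Ring.inverse_mul_cancel _ (isUnit_of_mem_freeNilGroup hn.1), mul_assoc _ m,
          Ring.mul_inverse_cancel _ (isUnit_of_mem_freeNilGroup hm.1), one_mul, mul_one]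
      set a := Ring.inverse n
      set b := Ring.inverse m
      have ih' : n - m ∈ filt d k l := by rw [← neg_sub]; exact neg_mem ih
      have h1 : a * (n - m) * b * x i ∈ filt d k l :=
        mul_mem_filt_left (mul_mem_filt_left (mul_mem_filt_right _ ih') _) _
      have h2 := tlog_sub_tlog_mem (l := l)
        (sub_one_mem_filt_of_mem_freeNilGroup (mul_mem_freeNilGroup hm' (hx i)))
        (sub_one_mem_filt_of_mem_freeNilGroup (mul_mem_freeNilGroup hn' (hx i)))
        (hdiff ▸ h1)
      rw [hdiff] at h2
      -- The factors `a`, `b` and `x i` all equal `1` modulo level one, so they do not affect the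
      -- leading term.
      have h3 : a * (n - m) * b * x i + (m - n) = (a - 1) * (n - m) * (b * x i) +
          (n - m) * (b - 1) * x i + (n - m) * (x i - 1) := by noncomm_ring
      have h4 : a * (n - m) * b * x i + (m - n) ∈ filt d k (l + 1) := by
        rw [h3]
        exact add_mem (add_mem (mul_mem_filt_left (add_comm 1 l ▸ mul_mem_filt hn1 ih') _)
          (mul_mem_filt_left (mul_mem_filt ih' hm1) _)) (mul_mem_filt ih' hi1)
      convert add_mem h2 h4 using 1
      abel
    have hsum := sum_mem (S := filt d k (l + 1)) (t := univ) fun i _ => hterm i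
    rw [sum_add_distrib, sum_sub_distrib, hm.2, hn.2, sub_zero, zero_add, sum_const, card_univ,
      Fintype.card_fin, ← Nat.cast_smul_eq_nsmul ℝ] at hsum
    exact ((filt d k (l + 1)).smul_mem_iff (by positivity)).1 hsum

theorem existsUnique_isBarycenter (hN : 1 ≤ N) {x : Fin N → TensorSeq d k}
    (hx : ∀ i, x i ∈ freeNilGroup d k) : ∃! m, IsBarycenter x m := by
  obtain ⟨m, hm, hF⟩ := exists_sum_tlog_mem_filt hN hx k
  have hm' : IsBarycenter x m := ⟨hm, eq_zero_of_mem_filt (Nat.lt_succ_self k) hF⟩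
  exact ⟨m, hm', fun n hn => sub_eq_zero.1 (eq_zero_of_mem_filt (Nat.lt_succ_self k)
    (sub_mem_filt_of_isBarycenter hN hx hn hm' (k + 1)))⟩

theorem isBarycenter_bary (hN : 1 ≤ N) {x : Fin N → TensorSeq d k}
    (hx : ∀ i, x i ∈ freeNilGroup d k) : IsBarycenter x (bary x) := by
  have h := (existsUnique_isBarycenter hN hx).exists
  rw [bary, dif_pos h]
  exact h.choose_spec

theorem TensorSeq.sum_apply {ι : Type*} (s : Finset ι) (f : ι → TensorSeq d k) (w : Word d k) :
    (∑ i ∈ s, f i) w = ∑ i ∈ s, f i w := Finset.sum_apply w s f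

/-! ### The exponential of a vector -/

/-- The vector `v`, as a tensor sequence concentrated in level one. -/
def vec (k : ℕ) (v : Fin d → ℝ) : TensorSeq d k := ∑ i, v i • letter d k i

theorem vec_mem_freeNilLie (v : Fin d → ℝ) : vec k v ∈ freeNilLie d k :=
  sum_mem fun i _ => (freeNilLie d k).smul_mem _ (letter_mem_freeNilLie i)

theorem vec_mem_filt (v : Fin d → ℝ) : vec k v ∈ filt d k 1 :=
  mem_filt_of_mem_freeNilLie (vec_mem_freeNilLie v)

theorem vec_neg (v : Fin d → ℝ) : vec k (-v) = -vec k v := by simp [vec]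

theorem vec_single (i : Fin d) (c : ℝ) : vec k (Pi.single i c) = c • letter d k i := by
  rw [vec, sum_eq_single i]
  · simp
  · intro j _ hj
    simp [hj]
  · simp

theorem vec_apply (v : Fin d → ℝ) (w : Word d k) :
    vec k v w = if w.1.length = 1 then (w.1.map v).prod else 0 := by
  rw [vec, TensorSeq.sum_apply]
  simp only [TensorSeq.smul_apply, letter]
  split_ifs with h
  · obtain ⟨c, hc⟩ := List.length_eq_one_iff.1 h
    simp [hc]
  · refine sum_eq_zero fun i _ => ?_
    rw [if_neg, mul_zero]
    rintro h'
    simp [h'] at h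

theorem vec_pow_apply (v : Fin d → ℝ) (n : ℕ) (w : Word d k) :
    (vec k v ^ n) w = if w.1.length = n then (w.1.map v).prod else 0 := by
  induction n generalizing w with
  | zero =>
    rw [pow_zero, TensorSeq.one_apply]
    simp only [List.length_eq_zero_iff]
    split_ifs with h <;> simp [h]
  | succ n ih =>
    rw [pow_succ', TensorSeq.mul_apply]
    obtain ⟨_ | ⟨c, w⟩, hw⟩ := w
    · simp [vec_apply, Word.take]
    · rw [sum_eq_single 1]
      · simp [vec_apply, ih, Word.take, Word.drop]
      · intro i hi hi1
        rw [vec_apply, if_neg, zero_mul]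
        simp only [Word.take, List.length_take, List.length_cons] at hi ⊢
        rw [mem_range] at hi
        omega
      · simp

theorem texp_vec_apply (v : Fin d → ℝ) (w : Word d k) :
    texp (vec k v) w = (w.1.length.factorial : ℝ)⁻¹ * (w.1.map v).prod := by
  rw [texp, TensorSeq.sum_apply, sum_eq_single w.1.length]
  · simp [vec_pow_apply]
  · intro i _ hi
    rw [TensorSeq.smul_apply, vec_pow_apply, if_neg hi.symm, mul_zero]
  · intro h
    exact absurd (mem_range.2 (Nat.lt_succ_of_le w.2)) h

theorem texp_vec_smul_apply (v : Fin d → ℝ) (t : ℝ) (w : Word d k) :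
    texp (vec k (t • v)) w =
      (w.1.length.factorial : ℝ)⁻¹ * (t ^ w.1.length * (w.1.map v).prod) := by
  rw [texp_vec_apply]
  congr 1
  induction w.1 with
  | nil => simp
  | cons c u ih =>
    simp only [List.map_cons, List.prod_cons, ih, List.length_cons, Pi.smul_apply, smul_eq_mul]
    ring

/-- The differential equation of the signature of a line. -/
theorem hasDerivAt_mul_texp_vec (S : TensorSeq d k) (v : Fin d → ℝ) (u : List (Fin d))
    (c : Fin d) (hu : u.length ≤ k) (huc : (u ++ [c]).length ≤ k) (t : ℝ) :
    HasDerivAt (fun t : ℝ => (S * texp (vec k (t • v))) ⟨u ++ [c], huc⟩)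
      ((S * texp (vec k (t • v))) ⟨u, hu⟩ * v c) t := by
  simp only [TensorSeq.mul_apply, texp_vec_smul_apply]
  simp only [Word.take, Word.drop, List.length_append, List.length_cons, List.length_nil, zero_add]
  simp only [sum_range_succ _ (u.length + 1)]
  -- The last summand splits off the empty word, so its exponential factor is `1` and it is constant
  -- in `t`.
  have hlast : ∀ t : ℝ, ((List.drop (u.length + 1) (u ++ [c])).length.factorial : ℝ)⁻¹ *
      (t ^ (List.drop (u.length + 1) (u ++ [c])).length *
        ((List.drop (u.length + 1) (u ++ [c])).map v).prod) = 1 := by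
    intro t
    simp
  simp only [hlast]
  rw [sum_mul]
  refine HasDerivAt.add_const _ (HasDerivAt.fun_sum fun i hi => ?_)
  have hi' : i ≤ u.length := by simpa [Nat.lt_succ_iff] using hi
  simp only [List.take_append_of_le_length hi', List.drop_append_of_le_length hi',
    List.map_append, List.prod_append, List.length_append, List.length_cons, List.length_nil,
    List.map_cons, List.map_nil, List.prod_cons, List.prod_nil, mul_one, zero_add]
  set n := (u.drop i).length
  set p := ((u.drop i).map v).prod
  have h := (((hasDerivAt_pow (n + 1) t).mul_const (p * v c)).const_mul
    (((n + 1).factorial : ℝ)⁻¹)).const_mul (S ⟨u.take i, (List.length_take_le' i u).trans hu⟩)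
  refine h.congr_deriv ?_
  rw [Nat.factorial_succ]
  push_cast
  field_simp

/-! ### Signatures of piecewise linear paths -/

/-- The iterated integrals of a path up to a variable end point. -/
def sigFold {d : ℕ} (X : ℝ → Fin d → ℝ) (w : List (Fin d)) : ℝ → ℝ :=
  w.foldl (fun (F : ℝ → ℝ) (a : Fin d) (T : ℝ) =>
    ∫ t in (0 : ℝ)..T, F t * deriv (fun s => X s a) t) (fun _ => 1)

theorem sigFold_append (X : ℝ → Fin d → ℝ) (w : List (Fin d)) (c : Fin d) (T : ℝ) :
    sigFold X (w ++ [c]) T = ∫ t in (0 : ℝ)..T, sigFold X w t * deriv (fun s => X s c) t := by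
  rw [sigFold, List.foldl_append]
  rfl

section Segment

variable {X : ℝ → Fin d → ℝ} {a b : ℝ} {v : Fin d → ℝ}

theorem deriv_eq_of_affine (hX : ∀ s ∈ Set.Icc a b, X s = X a + (s - a) • v) (c : Fin d) {t : ℝ}
    (ht : t ∈ Set.Ioo a b) : deriv (fun s => X s c) t = v c := by
  have h : (fun s => X s c) =ᶠ[nhds t] fun s => X a c + (s - a) * v c := by
    filter_upwards [Icc_mem_nhds ht.1 ht.2] with s hs
    rw [hX s hs]
    simp
  rw [h.deriv_eq]
  simp

variable {S : TensorSeq d k}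

theorem continuous_mul_texp_vec (S : TensorSeq d k) (v : Fin d → ℝ) (w : Word d k) :
    Continuous fun t : ℝ => (S * texp (vec k (t • v))) w := by
  simp only [TensorSeq.mul_apply, texp_vec_smul_apply]
  fun_prop

/-- The open interval is essential: at a breakpoint `deriv` need not be `v c`. The integrals do not
see these points. -/
theorem eqOn_segment (hX : ∀ s ∈ Set.Icc a b, X s = X a + (s - a) • v) {w : Word d k}
    (hw : ∀ T ∈ Set.Icc a b, sigFold X w.1 T = (S * texp (vec k ((T - a) • v))) w) (c : Fin d)
    {T : ℝ} (hT : T ∈ Set.Icc a b) :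
    Set.EqOn (fun t => (S * texp (vec k ((t - a) • v))) w * v c)
      (fun t => sigFold X w.1 t * deriv (fun s => X s c) t) (Set.uIoo a T) := by
  intro t ht
  rw [Set.uIoo_of_le hT.1] at ht
  have ht' : t ∈ Set.Ioo a b := ⟨ht.1, ht.2.trans_le hT.2⟩
  simp only
  rw [hw t (Set.Ioo_subset_Icc_self ht'), deriv_eq_of_affine hX c ht']

theorem intervalIntegrable_segment (hX : ∀ s ∈ Set.Icc a b, X s = X a + (s - a) • v)
    {w : Word d k}
    (hw : ∀ T ∈ Set.Icc a b, sigFold X w.1 T = (S * texp (vec k ((T - a) • v))) w) (c : Fin d)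
    {T : ℝ} (hT : T ∈ Set.Icc a b) :
    IntervalIntegrable (fun t => sigFold X w.1 t * deriv (fun s => X s c) t)
      MeasureTheory.volume a T :=
  ((((continuous_mul_texp_vec S v w).comp (continuous_id.sub continuous_const)).mul
    continuous_const).intervalIntegrable a T).congr_uIoo (eqOn_segment hX hw c hT)

/-- Chen's identity for the concatenation with a line. -/
theorem sigFold_segment (hX : ∀ s ∈ Set.Icc a b, X s = X a + (s - a) • v)
    (hS : ∀ w : Word d k, sigFold X w.1 a = S w)
    (hint : ∀ (w : Word d k) (c : Fin d), IntervalIntegrable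
      (fun t => sigFold X w.1 t * deriv (fun s => X s c) t) MeasureTheory.volume 0 a)
    (hS1 : S ⟨[], Nat.zero_le k⟩ = 1)
    (w : Word d k) {T : ℝ} (hT : T ∈ Set.Icc a b) :
    sigFold X w.1 T = (S * texp (vec k ((T - a) • v))) w := by
  obtain ⟨w, hw⟩ := w
  induction w using List.reverseRecOn generalizing T with
  | nil => simp [sigFold, TensorSeq.mul_apply, Word.take, Word.drop, texp_vec_apply, hS1]
  | append_singleton u c ih =>
    have hu : u.length ≤ k := by
      rw [List.length_append] at hw
      omega
    have ih' : ∀ T ∈ Set.Icc a b, sigFold X u T = (S * texp (vec k ((T - a) • v))) ⟨u, hu⟩ :=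
      fun T hT => ih hT hu
    have hi := intervalIntegrable_segment (w := ⟨u, hu⟩) hX ih' c hT
    have hSa := hS ⟨u ++ [c], hw⟩
    simp only [sigFold_append] at hSa ⊢
    rw [← intervalIntegral.integral_add_adjacent_intervals (hint ⟨u, hu⟩ c) hi, hSa,
      ← intervalIntegral.integral_congr_uIoo (eqOn_segment (w := ⟨u, hu⟩) hX ih' c hT),
      intervalIntegral.integral_eq_sub_of_hasDerivAt
        (f := fun t => (S * texp (vec k ((t - a) • v))) ⟨u ++ [c], hw⟩)
        (fun t _ => HasDerivAt.comp_sub_const t a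
          (hasDerivAt_mul_texp_vec S v u c hu hw (t - a)))
        ((((continuous_mul_texp_vec S v ⟨u, hu⟩).comp (continuous_id.sub
          continuous_const)).mul continuous_const).intervalIntegrable a T)]
    have h0 : texp (vec k ((a - a) • v)) = 1 := by
      rw [sub_self, zero_smul]
      simp [vec, texp_zero]
    simp only [h0, mul_one]
    ring

end Segment

theorem mul_texp_vec_apply_nil (S : TensorSeq d k) (v : Fin d → ℝ) :
    (S * texp (vec k v)) ⟨[], Nat.zero_le k⟩ = S ⟨[], Nat.zero_le k⟩ := by
  simp [TensorSeq.mul_apply, Word.take, Word.drop, texp_vec_apply]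

theorem sigFold_zero (X : ℝ → Fin d → ℝ) (w : Word d k) :
    sigFold X w.1 0 = (1 : TensorSeq d k) w := by
  obtain ⟨w, hw⟩ := w
  rw [TensorSeq.one_apply]
  rcases w.eq_nil_or_concat with rfl | ⟨u, c, rfl⟩
  · simp [sigFold]
  · simp [sigFold_append]

/-- The signature of a piecewise linear path is the product of the exponentials of its
increments. -/
theorem signature_eq_partialProd {m : ℕ} {X : ℝ → Fin d → ℝ} {t : Fin (m + 1) → ℝ}
    (ht : StrictMono t) (h0 : t 0 = 0) (h1 : t (Fin.last m) = 1) {v : Fin m → Fin d → ℝ}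
    (hX : ∀ i : Fin m, ∀ s ∈ Set.Icc (t i.castSucc) (t i.succ),
      X s = X (t i.castSucc) + (s - t i.castSucc) • v i) :
    signature k X =
      Fin.partialProd (fun i => texp (vec k ((t i.succ - t i.castSucc) • v i))) (Fin.last m) := by
  set S := Fin.partialProd (fun i => texp (vec k ((t i.succ - t i.castSucc) • v i))) with hSdef
  -- Integrability up to the breakpoint and the constant component `1` are carried along because
  -- `sigFold_segment` needs them for the next segment.
  have key : ∀ j : Fin (m + 1), (∀ w : Word d k, sigFold X w.1 (t j) = S j w) ∧
      (∀ (w : Word d k) (c : Fin d), IntervalIntegrable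
        (fun t => sigFold X w.1 t * deriv (fun s => X s c) t) MeasureTheory.volume 0 (t j)) ∧
      S j ⟨[], Nat.zero_le k⟩ = 1 := by
    intro j
    induction j using Fin.induction with
    | zero =>
      refine ⟨fun w => ?_, fun w c => ?_, ?_⟩
      · rw [h0, sigFold_zero, hSdef, Fin.partialProd_zero]
      · rw [h0]
      · rw [hSdef, Fin.partialProd_zero, TensorSeq.one_apply]
        simp
    | succ j ih =>
      obtain ⟨ih1, ih2, ih3⟩ := ih
      have hle : t j.castSucc ≤ t j.succ := ht.monotone (Fin.castSucc_lt_succ).le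
      have hseg := fun (w : Word d k) (T : ℝ) (hT : T ∈ Set.Icc (t j.castSucc) (t j.succ)) =>
        sigFold_segment (hX j) ih1 ih2 ih3 w hT
      have hSs : S j.succ =
          S j.castSucc * texp (vec k ((t j.succ - t j.castSucc) • v j)) := by
        rw [hSdef, Fin.partialProd_succ]
      refine ⟨fun w => ?_, fun w c => ?_, ?_⟩
      · rw [hseg w _ (Set.right_mem_Icc.2 hle), hSs]
      · exact (ih2 w c).trans
          (intervalIntegrable_segment (hX j) (hseg w) c (Set.right_mem_Icc.2 hle))
      · rw [hSs, mul_texp_vec_apply_nil, ih3]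
  ext w
  rw [← (key (Fin.last m)).1 w, h1]
  rfl

/-- The products of `n` exponentials of vectors. -/
def expProducts (d k n : ℕ) : Set (TensorSeq d k) :=
  {g | ∃ l : List (Fin d → ℝ), l.length = n ∧ (l.map fun v => texp (vec k v)).prod = g}

theorem plSignatures_subset_expProducts (m : ℕ) :
    plSignatures d k m ⊆ expProducts d k m := by
  rintro _ ⟨X, ⟨-, t, ht, h0, h1, hX⟩, rfl⟩
  choose v hv using hX
  rw [signature_eq_partialProd ht h0 h1 hv]
  refine ⟨List.ofFn fun i => (t i.succ - t i.castSucc) • v i, by simp, ?_⟩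
  rw [Fin.partialProd, Fin.val_last, List.take_of_length_le (by simp), List.map_ofFn]
  rfl

theorem expProducts_subset_plSignatures {m : ℕ} (hm : 1 ≤ m) :
    expProducts d k m ⊆ plSignatures d k m := by
  rintro _ ⟨l, rfl, rfl⟩
  set m := l.length
  have hm0 : (0 : ℝ) < m := by exact_mod_cast hm
  -- The clamped coefficient of the `i`-th vector runs from `0` to `1` on the `i`-th of `m` equal
  -- subintervals and is constant elsewhere; the velocity there is `m` times the vector.
  let X : ℝ → Fin d → ℝ := fun s => ∑ i : Fin m, max 0 (min 1 (m * s - (i : ℕ))) • l.get i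
  let t : Fin (m + 1) → ℝ := fun j => (j : ℕ) / m
  have ht : StrictMono t := fun i j hij => by
    have : ((i : ℕ) : ℝ) < (j : ℕ) := by exact_mod_cast hij
    exact div_lt_div_of_pos_right this hm0
  have h0 : t 0 = 0 := by simp [t]
  have h1 : t (Fin.last m) = 1 := by simp [t, hm0.ne']
  have hX : ∀ i : Fin m, ∀ s ∈ Set.Icc (t i.castSucc) (t i.succ),
      X s = X (t i.castSucc) + (s - t i.castSucc) • ((m : ℝ) • l.get i) := by
    intro i s hs
    have hs1 : ((i : ℕ) : ℝ) ≤ m * s := by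
      have := (div_le_iff₀ hm0).1 hs.1
      rw [mul_comm]
      simpa using this
    have hs2 : m * s ≤ (i : ℕ) + 1 := by
      have := (le_div_iff₀ hm0).1 hs.2
      rw [mul_comm]
      simpa using this
    have hti : m * t i.castSucc = (i : ℕ) := mul_div_cancel₀ _ hm0.ne'
    rw [← sub_eq_iff_eq_add']
    simp only [X]
    rw [← sum_sub_distrib, sum_eq_single i]
    · rw [hti, ← sub_smul, smul_smul, sub_self, sub_mul, mul_comm (t i.castSucc), hti,
        min_eq_right (by linarith), max_eq_right (by linarith)]
      simp [mul_comm]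
    · intro j _ hji
      rw [hti, ← sub_smul]
      rcases lt_or_gt_of_ne hji with h | h
      · have h' : ((j : ℕ) : ℝ) + 1 ≤ (i : ℕ) := by exact_mod_cast h
        rw [min_eq_left (by linarith), min_eq_left (by linarith), sub_self, zero_smul]
      · have h' : ((i : ℕ) : ℝ) + 1 ≤ (j : ℕ) := by exact_mod_cast h
        rw [max_eq_left (min_le_iff.2 (Or.inr (by linarith))),
          max_eq_left (min_le_iff.2 (Or.inr (by linarith))), sub_self, zero_smul]
    · simp
  refine ⟨X, ⟨?_, t, ht, h0, h1, fun i => ⟨_, hX i⟩⟩, ?_⟩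
  · refine sum_eq_zero fun i _ => ?_
    have : (0 : ℝ) ≤ (i : ℕ) := Nat.cast_nonneg _
    rw [max_eq_left (min_le_iff.2 (Or.inr (by simp))), zero_smul]
  · rw [signature_eq_partialProd ht h0 h1 hX, Fin.partialProd, Fin.val_last,
      List.take_of_length_le (by simp)]
    congr 1
    have : ∀ i : Fin m, (t i.succ - t i.castSucc) • ((m : ℝ) • l.get i) = l.get i := by
      intro i
      have : (t i.succ - t i.castSucc) * m = 1 := by
        simp only [t, Fin.val_succ, Fin.val_castSucc]
        field_simp
        push_cast
        ring
      rw [smul_smul, this, one_smul]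
    simp only [this]
    refine List.ext_getElem (by simp [m]) fun i h _ => by simp

/-! ### Products of exponentials of vectors -/

theorem expProducts_subset_freeNilGroup (n : ℕ) : expProducts d k n ⊆ freeNilGroup d k := by
  rintro _ ⟨l, -, rfl⟩
  induction l with
  | nil => exact one_mem_freeNilGroup
  | cons v l ih =>
    exact mul_mem_freeNilGroup (texp_mem_freeNilGroup (vec_mem_freeNilLie v)) ih

theorem one_mem_expProducts : (1 : TensorSeq d k) ∈ expProducts d k 0 := ⟨[], rfl, rfl⟩

theorem texp_vec_mem_expProducts (v : Fin d → ℝ) : texp (vec k v) ∈ expProducts d k 1 :=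
  ⟨[v], rfl, by simp⟩

theorem mul_mem_expProducts {m n : ℕ} {g h : TensorSeq d k} (hg : g ∈ expProducts d k m)
    (hh : h ∈ expProducts d k n) : g * h ∈ expProducts d k (m + n) := by
  obtain ⟨l, rfl, rfl⟩ := hg
  obtain ⟨l', rfl, rfl⟩ := hh
  exact ⟨l ++ l', by simp, by simp⟩

theorem inverse_mem_expProducts {n : ℕ} {g : TensorSeq d k} (hg : g ∈ expProducts d k n) :
    Ring.inverse g ∈ expProducts d k n := by
  obtain ⟨l, rfl, rfl⟩ := hg
  induction l with
  | nil => simpa using one_mem_expProducts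
  | cons v l ih =>
    rw [List.map_cons, List.prod_cons,
      Ring.inverse_mul (Or.inl (isUnit_texp (vec_mem_filt v))), inverse_texp (vec_mem_filt v),
      ← vec_neg]
    exact mul_mem_expProducts ih (texp_vec_mem_expProducts _)

theorem expProducts_mono {m n : ℕ} (h : m ≤ n) : expProducts d k m ⊆ expProducts d k n := by
  obtain ⟨j, rfl⟩ := Nat.exists_eq_add_of_le h
  rintro _ ⟨l, rfl, rfl⟩
  refine ⟨l ++ List.replicate j 0, by simp, ?_⟩
  have : texp (vec k (0 : Fin d → ℝ)) = 1 := by simp [vec, texp_zero]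
  simp [this]

/-! ### Right-nested brackets of letters -/

/-- The right-nested bracket `⁅e_{w₁}, ⁅e_{w₂}, …⁆⁆` of the letters of a word. -/
def nestedBracket (d k : ℕ) : List (Fin d) → TensorSeq d k
  | [] => 0
  | [a] => letter d k a
  | a :: b :: u => ⁅letter d k a, nestedBracket d k (b :: u)⁆

theorem lie_letter_mem_span {x : TensorSeq d k} (a : Fin d)
    (hx : x ∈ Submodule.span ℝ (Set.range (nestedBracket d k))) :
    ⁅letter d k a, x⁆ ∈ Submodule.span ℝ (Set.range (nestedBracket d k)) := by
  induction hx using Submodule.span_induction with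
  | mem x hx =>
    obtain ⟨_ | ⟨b, u⟩, rfl⟩ := hx
    · rw [nestedBracket, lie_zero]; exact zero_mem _
    · exact Submodule.subset_span ⟨a :: b :: u, rfl⟩
  | zero => rw [lie_zero]; exact zero_mem _
  | add x y _ _ hx hy => rw [lie_add]; exact add_mem hx hy
  | smul r x _ hx => rw [lie_smul]; exact Submodule.smul_mem _ r hx

/-- The Jacobi identity reduces the bracket with a Lie element to successive brackets with letters,
which only lengthen the nested brackets. -/
theorem lie_mem_span {y : TensorSeq d k} (hy : y ∈ freeNilLie d k) :
    ∀ x ∈ Submodule.span ℝ (Set.range (nestedBracket d k)),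
      ⁅y, x⁆ ∈ Submodule.span ℝ (Set.range (nestedBracket d k)) := by
  refine LieSubalgebra.lieSpan_induction (R := ℝ)
    (p := fun y _ => ∀ x ∈ Submodule.span ℝ (Set.range (nestedBracket d k)),
      ⁅y, x⁆ ∈ Submodule.span ℝ (Set.range (nestedBracket d k))) ?_ ?_ ?_ ?_ ?_ hy
  · rintro _ ⟨a, rfl⟩ x hx
    exact lie_letter_mem_span a hx
  · intro x _
    rw [zero_lie]; exact zero_mem _
  · intro y z _ _ hy hz x hx
    rw [add_lie]; exact add_mem (hy x hx) (hz x hx)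
  · intro r y _ hy x hx
    rw [smul_lie]; exact Submodule.smul_mem _ r (hy x hx)
  · intro y z _ _ hy hz x hx
    rw [lie_lie]; exact sub_mem (hy _ (hz x hx)) (hz _ (hy x hx))

theorem freeNilLie_le_span :
    (freeNilLie d k).toSubmodule ≤ Submodule.span ℝ (Set.range (nestedBracket d k)) := by
  intro x hx
  refine LieSubalgebra.lieSpan_induction (R := ℝ)
    (p := fun x _ => x ∈ Submodule.span ℝ (Set.range (nestedBracket d k))) ?_ ?_ ?_ ?_ ?_ hx
  · rintro _ ⟨a, rfl⟩
    exact Submodule.subset_span ⟨[a], rfl⟩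
  · exact zero_mem _
  · exact fun _ _ _ _ => add_mem
  · exact fun r _ _ => Submodule.smul_mem _ r
  · exact fun _ _ hx _ _ hy => lie_mem_span hx _ hy

theorem degDer_nestedBracket (w : List (Fin d)) :
    degDer d k (nestedBracket d k w) = (w.length : ℝ) • nestedBracket d k w := by
  induction w with
  | nil => simp [nestedBracket]
  | cons a u ih =>
    rcases u with _ | ⟨b, u⟩
    · simp [nestedBracket, degDer_letter]
    · rw [nestedBracket, degDer_lie, ih, degDer_letter, lie_smul, List.length_cons (a := a)]
      push_cast
      module

/-- A nested bracket is an eigenvector of `degDer`, so it is concentrated in the level given by its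
eigenvalue. -/
theorem nestedBracket_apply_of_ne {w : List (Fin d)} {u : Word d k} (h : u.1.length ≠ w.length) :
    nestedBracket d k w u = 0 := by
  have h1 := congrArg (fun a : TensorSeq d k => a u) (degDer_nestedBracket (k := k) w)
  simp only [degDer_apply, TensorSeq.smul_apply] at h1
  by_contra h2
  exact h (Nat.cast_injective (mul_right_cancel₀ h2 h1))

theorem nestedBracket_mem_filt (w : List (Fin d)) :
    nestedBracket d k w ∈ filt d k w.length :=
  fun _ hu => nestedBracket_apply_of_ne hu.ne

/-- The projection to level `l`. -/
def levelProj (d k l : ℕ) : Module.End ℝ (TensorSeq d k) where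
  toFun a w := if w.1.length = l then a w else 0
  map_add' a b := by
    ext w
    change (if w.1.length = l then a w + b w else 0) =
      (if w.1.length = l then a w else 0) + (if w.1.length = l then b w else 0)
    split_ifs <;> simp
  map_smul' r a := by
    ext w
    exact (mul_ite_zero (w.1.length = l) r (a w)).symm

theorem levelProj_apply (l : ℕ) (a : TensorSeq d k) (w : Word d k) :
    levelProj d k l a w = if w.1.length = l then a w else 0 := rfl

theorem sub_levelProj_mem {l : ℕ} {x : TensorSeq d k} (hx : x ∈ filt d k l) :
    x - levelProj d k l x ∈ filt d k (l + 1) := by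
  intro w hw
  rw [sub_eq_add_neg, ← neg_one_smul ℝ, TensorSeq.add_apply, TensorSeq.smul_apply,
    levelProj_apply]
  split_ifs with h
  · ring
  · rw [hx w (by omega)]
    ring

/-- The leading term of a Lie element is a combination of nested brackets. -/
theorem exists_sub_sum_nestedBracket_mem {l : ℕ} {x : TensorSeq d k} (hx : x ∈ freeNilLie d k)
    (hl : x ∈ filt d k l) : ∃ c : (Fin l → Fin d) → ℝ,
      x - ∑ w, c w • nestedBracket d k (List.ofFn w) ∈ filt d k (l + 1) := by
  -- By homogeneity the projection fixes the brackets of words of length `l` and kills all others.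
  have h : levelProj d k l x ∈
      Submodule.span ℝ (Set.range fun w : Fin l → Fin d => nestedBracket d k (List.ofFn w)) := by
    have h1 := Submodule.mem_map_of_mem (f := levelProj d k l) (freeNilLie_le_span hx)
    refine Submodule.map_span_le _ _ _ |>.2 ?_ h1
    rintro _ ⟨w, rfl⟩
    by_cases hw : w.length = l
    · subst hw
      refine Submodule.subset_span ⟨w.get, ?_⟩
      ext u
      rw [levelProj_apply]
      simp only [List.ofFn_get]
      split_ifs with hu
      · rfl
      · exact nestedBracket_apply_of_ne hu
    · have : levelProj d k l (nestedBracket d k w) = 0 := by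
        ext u
        rw [levelProj_apply]
        split_ifs with hu
        · exact nestedBracket_apply_of_ne fun h => hw (h.symm.trans hu)
        · rfl
      rw [this]
      exact zero_mem _
  obtain ⟨c, hc⟩ := (Submodule.mem_span_range_iff_exists_fun ℝ).1 h
  refine ⟨c, ?_⟩
  rw [hc]
  exact sub_levelProj_mem hl

/-! ### Every group element is a bounded product of exponentials of vectors -/

/-- Group commutators realize nested brackets to leading order. -/
theorem exists_expProducts_nestedBracket (w : List (Fin d)) (hw : w ≠ []) :
    ∃ n, ∀ c : ℝ, ∃ h ∈ expProducts d k n,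
      h - 1 - c • nestedBracket d k w ∈ filt d k (w.length + 1) := by
  induction w with
  | nil => exact absurd rfl hw
  | cons a u ih =>
    rcases u with _ | ⟨b, u⟩
    -- The scalar is absorbed into the innermost letter, so the number of factors does not depend on
    -- `c`.
    · refine ⟨1, fun c => ⟨_, texp_vec_mem_expProducts (Pi.single a c), ?_⟩⟩
      have := texp_sub_one_sub_mem le_rfl (vec_mem_filt (k := k) (Pi.single a c))
      rwa [vec_single] at this ⊢
    · obtain ⟨n, hn⟩ := ih (by simp)
      refine ⟨1 + n + (1 + n), fun c => ?_⟩
      obtain ⟨h, hh, hhc⟩ := hn c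
      have hr := nestedBracket_mem_filt (k := k) (b :: u)
      set e := letter d k a with he
      set r := nestedBracket d k (b :: u) with hrdef
      set l := (b :: u).length with hl
      have hx := texp_vec_mem_expProducts (k := k) (Pi.single a 1)
      have hxe := texp_sub_one_sub_mem le_rfl (vec_mem_filt (k := k) (Pi.single a 1))
      rw [vec_single, one_smul, ← he] at hxe hx
      set x := texp e with hxdef
      have hy := mul_mem_expProducts (inverse_mem_expProducts hx) (inverse_mem_expProducts hh)
      have hy1 := sub_one_mem_filt_of_mem_freeNilGroup (expProducts_subset_freeNilGroup _ hy)
      have hhu := isUnit_of_mem_freeNilGroup (expProducts_subset_freeNilGroup _ hh)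
      have hxu := isUnit_of_mem_freeNilGroup (expProducts_subset_freeNilGroup _ hx)
      refine ⟨_, mul_mem_expProducts (mul_mem_expProducts hx hh) hy, ?_⟩
      have hhxy : h * x * (Ring.inverse x * Ring.inverse h) = 1 := by
        rw [mul_assoc, Ring.mul_inverse_cancel_left _ _ hxu, Ring.mul_inverse_cancel _ hhu]
      set y := Ring.inverse x * Ring.inverse h
      have hrl : c • r ∈ filt d k l := Submodule.smul_mem _ _ hr
      have hh1 : h - 1 ∈ filt d k l := by
        simpa using add_mem (filt_anti (Nat.le_succ l) hhc) hrl
      have he1 : e ∈ filt d k 1 := letter_mem_filt a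
      have hx1 : x - 1 ∈ filt d k 1 := texp_sub_one_mem le_rfl he1
      have h1 : ⁅e, h - 1 - c • r⁆ ∈ filt d k (l + 1 + 1) :=
        add_comm 1 (l + 1) ▸ lie_mem_filt he1 hhc
      have h2 : ⁅x - 1 - e, h - 1⁆ ∈ filt d k (l + 1 + 1) :=
        filt_anti (by omega) (lie_mem_filt hxe hh1)
      have h3 : ⁅x - 1, h - 1⁆ * (y - 1) ∈ filt d k (l + 1 + 1) :=
        filt_anti (by omega) (mul_mem_filt (lie_mem_filt hx1 hh1) hy1)
      have hlie : ⁅x - 1, h - 1⁆ = x * h - h * x := by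
        rw [Ring.lie_def]; noncomm_ring
      -- Since `h * x * y = 1`, the group commutator minus `1` is `(x * h - h * x) * y`, that is,
      -- `⁅x - 1, h - 1⁆ * y`, with leading term `c • ⁅e, r⁆`.
      have key : x * h * y - 1 - c • nestedBracket d k (a :: b :: u) =
          ⁅x - 1, h - 1⁆ * (y - 1) + ⁅x - 1 - e, h - 1⁆ + ⁅e, h - 1 - c • r⁆ := by
        have e1 : ⁅x - 1 - e, h - 1⁆ + ⁅e, h - 1 - c • r⁆ = ⁅x - 1, h - 1⁆ - c • ⁅e, r⁆ := by
          rw [← lie_smul]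
          simp only [sub_lie, lie_sub]
          abel
        rw [add_assoc, e1, hlie, nestedBracket, ← hrdef, mul_sub, sub_mul, hhxy]
        simp only [mul_one]
        abel
      rw [key]
      exact add_mem (add_mem h3 h2) h1

/-- Products of elements close to `1` add their leading terms: the cross term has level at least `2
* l`, which exceeds `l` because `1 ≤ l`. -/
theorem exists_expProducts_sum {l : ℕ} (hl : 1 ≤ l) (s : Finset (Fin l → Fin d)) :
    ∃ n, ∀ c : (Fin l → Fin d) → ℝ, ∃ h ∈ expProducts d k n,
      h - 1 - ∑ w ∈ s, c w • nestedBracket d k (List.ofFn w) ∈ filt d k (l + 1) := by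
  classical
  induction s using Finset.induction_on with
  | empty => exact ⟨0, fun c => ⟨1, one_mem_expProducts, by simp⟩⟩
  | insert w s hws ih =>
    obtain ⟨n, hn⟩ := ih
    obtain ⟨m, hm⟩ := exists_expProducts_nestedBracket (k := k) (List.ofFn w)
      (fun h => by simp at h; omega)
    refine ⟨m + n, fun c => ?_⟩
    obtain ⟨g, hg, hgc⟩ := hm (c w)
    obtain ⟨h, hh, hhc⟩ := hn c
    refine ⟨g * h, mul_mem_expProducts hg hh, ?_⟩
    have hmem : ∀ v : Fin l → Fin d, c v • nestedBracket d k (List.ofFn v) ∈ filt d k l :=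
      fun v => Submodule.smul_mem _ _ (by simpa using nestedBracket_mem_filt (List.ofFn v))
    rw [List.length_ofFn] at hgc
    have hg1 : g - 1 ∈ filt d k l := by
      simpa using add_mem (filt_anti (Nat.le_succ l) hgc) (hmem w)
    have hh1 : h - 1 ∈ filt d k l := by
      simpa using add_mem (filt_anti (Nat.le_succ l) hhc) (sum_mem fun v (_ : v ∈ s) => hmem v)
    have h1 : (g - 1) * (h - 1) ∈ filt d k (l + 1) :=
      filt_anti (by omega) (mul_mem_filt hg1 hh1)
    rw [sum_insert hws]
    convert add_mem (add_mem hgc hhc) h1 using 1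
    noncomm_ring

/-- The induction starts at the trivial subgroup above level `k` and descends one level at a time.
Each step divides `g` on the left by a product `h` with the same leading term. The bound must
precede `g`, since one number of factors has to serve the whole group. -/
theorem exists_mem_expProducts_of_filt (j : ℕ) (hj : j ≤ k) :
    ∃ n, ∀ g ∈ freeNilGroup d k, g - 1 ∈ filt d k (k - j + 1) → g ∈ expProducts d k n := by
  induction j with
  | zero =>
    refine ⟨0, fun g _ hg => ?_⟩
    rw [sub_eq_zero.1 (eq_zero_of_mem_filt (by omega) hg)]
    exact one_mem_expProducts
  | succ j ih =>
    obtain ⟨n, hn⟩ := ih (by omega)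
    obtain ⟨l, hl⟩ : ∃ l, k - j = l := ⟨_, rfl⟩
    rw [hl] at hn
    rw [show k - (j + 1) + 1 = l by omega]
    have hl1 : 1 ≤ l := by omega
    obtain ⟨m, hm⟩ := exists_expProducts_sum (k := k) hl1 (univ : Finset (Fin l → Fin d))
    refine ⟨m + n, fun g hg hg1 => ?_⟩
    have hz := tlog_mem_filt hg1
    obtain ⟨c, hc⟩ := exists_sub_sum_nestedBracket_mem (tlog_mem_freeNilLie hg) hz
    obtain ⟨h, hh, hhc⟩ := hm c
    have hhG := expProducts_subset_freeNilGroup _ hh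
    have hu := isUnit_of_mem_freeNilGroup hhG
    have hgz := texp_sub_one_sub_mem hl1 hz
    rw [texp_tlog (sub_one_mem_filt_of_mem_freeNilGroup hg)] at hgz
    have hgh : g - h ∈ filt d k (l + 1) := by
      convert sub_mem (add_mem hgz hc) hhc using 1
      abel
    have h1 : Ring.inverse h * g - 1 = Ring.inverse h * (g - h) := by
      rw [mul_sub, Ring.inverse_mul_cancel _ hu]
    have := mul_mem_expProducts hh (hn _ (inverse_mul_mem_freeNilGroup hhG hg)
      (h1 ▸ mul_mem_filt_right _ hgh))
    rwa [Ring.mul_inverse_cancel_left _ _ hu] at this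

theorem exists_freeNilGroup_subset_plSignatures (d k : ℕ) :
    ∃ m, 1 ≤ m ∧ freeNilGroup d k ⊆ plSignatures d k m := by
  obtain ⟨n, hn⟩ := exists_mem_expProducts_of_filt (d := d) (k := k) k le_rfl
  -- The extra factor ensures at least one segment, as `n` may be zero.
  refine ⟨n + 1, by omega, fun g hg => expProducts_subset_plSignatures (by omega)
    (expProducts_mono (Nat.le_succ n) (hn g hg ?_))⟩
  simpa using sub_one_mem_filt_of_mem_freeNilGroup hg

end BarySig

end

theorem mainTheorem6 (d k N : ℕ) (hN : 1 ≤ N) (α : Fin N → ℕ) (hα : ∀ i, 1 ≤ α i) :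
    (∀ i, BarySig.plSignatures d k (α i) ⊆ BarySig.freeNilGroup d k) ∧
    (∀ x : Fin N → BarySig.TensorSeq d k, (∀ i, x i ∈ BarySig.freeNilGroup d k) →
      ∃! m, BarySig.IsBarycenter x m) ∧
    IsLeast (BarySig.recoverySet d k α) (BarySig.baryOrder d k α) := by
  have h1 : ∀ i, BarySig.plSignatures d k (α i) ⊆ BarySig.freeNilGroup d k := fun i =>
    (BarySig.plSignatures_subset_expProducts _).trans
      (BarySig.expProducts_subset_freeNilGroup _)
  refine ⟨h1, fun x hx => BarySig.existsUnique_isBarycenter hN hx, Nat.sInf_mem ?_,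
    fun m hm => Nat.sInf_le hm⟩
  obtain ⟨m, hm, hsub⟩ := BarySig.exists_freeNilGroup_subset_plSignatures d k
  refine ⟨m, hm, ?_⟩
  rintro _ ⟨x, hx, rfl⟩
  exact hsub (BarySig.isBarycenter_bary hN fun i => h1 i (hx i trivial)).1
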